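/- Let $m\ge 2$ be an integer and let $\mathcal A^{\mathbb N}$ be the set of infinite words $\omega=\omega_1\omega_2\cdots$ over $\mathcal A=\{0,1,\dots,m-1\}$, with the metric $d(u,\omega)=m^{-\min\{i\ge 1:\,u_i\ne\omega_i\}}$ for $u\neq\omega$, $d(u,u)=0$, and the shift $(\sigma u)_i=u_{i+1}$. Let $\Sigma\subset\mathcal A^{\mathbb N}$ be a subshift, i.e. a closed set with $\sigma(\Sigma)\subset\Sigma$; let $\Sigma^n$ be the set of prefixes of length $n$ of elements of $\Sigma$, and $\Sigma^*=\bigcup_{n\ge1}\Sigma^n$. Assume that - $\Sigma$ has specification: there is $M\in\mathbb N$ such that for all $u,v\in\Sigma^*$ there is $w\in\Sigma^M$ with $uwv\in\Sigma^*$; - the topological entropy $h(\Sigma)=\lim_{n\to\infty}\frac1n\log\sharp\Sigma^n$ is positive; - $0^\infty\in\Sigma$. For $\omega\in\Sigma$ put $l_n(\omega)=\sup\{k\ge0:\omega_{n+i}=0\ \forall\,1\le i\le k\}\in[0,\infty]$ and $L_N(\omega)=\max_{1\le n\le N}l_n(\omega)$, and write $\underline L(\omega)=\liminf_{N\to\infty}L_N(\omega)/N$,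 $\overline L(\omega)=\limsup_{N\to\infty}L_N(\omega)/N$. Let $\psi_0(N)=m^{-N}$, so that $-\log_m\psi_0(N)=N$, and $$\mathcal U_{\psi_0}(a,b)=\Big\{\omega\in\Sigma:\ \liminf_{N\to\infty}\tfrac{L_N(\omega)}{-\log_m\psi_0(N)}\ge a,\ \limsup_{N\to\infty}\tfrac{L_N(\omega)}{-\log_m\psi_0(N)}=b\Big\},$$ $$\mathcal U^*_{\psi_0}(a,b)=\Big\{\omega\in\Sigma:\ \liminf_{N\to\infty}\tfrac{L_N(\omega)}{-\log_m\psi_0(N)}=a,\ \limsup_{N\to\infty}\tfrac{L_N(\omega)}{-\log_m\psi_0(N)}=b\Big\}.$$ Let $0\le a<1$ and $b\in[0,\infty]$. (i) If $b<\frac{a}{1-a}$, then $\mathcal U_{\psi_0}(a,b)=\emptyset$. (ii) If $b\ge\frac{a}{1-a}$, then $$\dim_{\rm H}\mathcal U^*_{\psi_0}(a,b)=\dim_{\rm H}\mathcal U_{\psi_0}(a,b)=\frac{b(1-a)-a}{(1+b)(b-a)}\,\dim_{\rm H}\Sigma ,$$ where the fraction is read as $1$ if $a=b=0$ and as its limit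 $0$ if $b=\infty$. Furthermore, with the same reading, for every real $\varrho>0$, $$\dim_{\rm H}\{\omega\in\Sigma:\ \underline L(\omega)\ge a,\ b\le\overline L(\omega)\le b+\varrho\}\le\Big(\frac{b(1-a)-a}{(1+b)(b-a)}+\frac{\varrho(1-a)^2}{a^3}\Big)\dim_{\rm H}\Sigma$$ (for $a=0$ the right-hand side is $+\infty$). -/

import Mathlib

open Filter Topology
open scoped ENNReal

noncomputable section

namespace ZeroRuns

/-- The space of infinite words over the alphabet `{0, …, m - 1}`. Words are indexed from `0`
here, so the `j`-th letter (`j ≥ 1`) of the word usually written `ω₁ω₂⋯` is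
`ω.letter (j - 1)`. -/
@[ext]
structure SymbolicSpace (m : ℕ) where
  letter : ℕ → Fin m

variable {m : ℕ}

/-- `d(u, v) = m ^ (-min {i ≥ 1 : u_i ≠ v_i})` for `u ≠ v`, and `d(u, u) = 0`. The first index
of disagreement, counted from `0`, is `PiNat.firstDiff u.letter v.letter`. -/
def symDist (u v : SymbolicSpace m) : ℝ :=
  open Classical in
  if u = v then 0
  else ((m : ℝ)⁻¹) ^ (PiNat.firstDiff (E := fun _ : ℕ => Fin m) u.letter v.letter + 1)

theorem symDist_self (u : SymbolicSpace m) : symDist u u = 0 := by simp [symDist]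

theorem symDist_comm (u v : SymbolicSpace m) : symDist u v = symDist v u := by
  by_cases h : u = v
  · rw [h]
  · simp only [symDist, h, Ne.symm h, if_false]
    rw [PiNat.firstDiff_comm]

theorem one_le_of_word (u : SymbolicSpace m) : 1 ≤ m := by
  have := (u.letter 0).2
  omega

theorem symDist_nonneg (u v : SymbolicSpace m) : 0 ≤ symDist u v := by
  unfold symDist
  split_ifs <;> positivity

theorem symDist_triangle (u v w : SymbolicSpace m) :
    symDist u w ≤ symDist u v + symDist v w := by
  by_cases huw : u = w
  · subst huw
    rw [symDist_self]
    exact add_nonneg (symDist_nonneg _ _) (symDist_nonneg _ _)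
  by_cases huv : u = v
  · subst huv
    simp [symDist_self]
  by_cases hvw : v = w
  · subst hvw
    simp [symDist_self]
  have h1 : (1 : ℝ) ≤ (m : ℝ) := by exact_mod_cast one_le_of_word u
  have hi0 : 0 ≤ (m : ℝ)⁻¹ := by positivity
  have hi1 : (m : ℝ)⁻¹ ≤ 1 := inv_le_one_of_one_le₀ h1
  have hmin := PiNat.min_firstDiff_le (E := fun _ : ℕ => Fin m) u.letter v.letter w.letter
    (fun h => huw (SymbolicSpace.ext h))
  have p1 := symDist_nonneg u v
  have p2 := symDist_nonneg v w
  rcases min_le_iff.1 hmin with h | h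
  · have : symDist u w ≤ symDist u v := by
      simp only [symDist, huw, huv, if_false]
      exact pow_le_pow_of_le_one hi0 hi1 (by omega)
    linarith
  · have : symDist u w ≤ symDist v w := by
      simp only [symDist, huw, hvw, if_false]
      exact pow_le_pow_of_le_one hi0 hi1 (by omega)
    linarith

theorem eq_of_symDist_eq_zero (u v : SymbolicSpace m) (h : symDist u v = 0) : u = v := by
  by_contra huv
  have h1 : (0 : ℝ) < (m : ℝ) := by exact_mod_cast one_le_of_word u
  simp only [symDist, huv, if_false] at h
  have : 0 < ((m : ℝ)⁻¹) ^ (PiNat.firstDiff (E := fun _ : ℕ => Fin m) u.letter v.letter + 1) := by positivity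
  linarith

instance instMetricSpaceSymbolicSpace : MetricSpace (SymbolicSpace m) where
  dist := symDist
  dist_self := symDist_self
  dist_comm := symDist_comm
  dist_triangle := symDist_triangle
  eq_of_dist_eq_zero := fun {u v} h => eq_of_symDist_eq_zero u v h

/-- The shift map `σ`. -/
def shift (u : SymbolicSpace m) : SymbolicSpace m := ⟨fun i => u.letter (i + 1)⟩

/-- The word `0^∞`. -/
def zeroWord (m : ℕ) [NeZero m] : SymbolicSpace m := ⟨fun _ => 0⟩

/-- A subshift: a closed set `S` with `σ(S) ⊆ S`. -/
def IsSubshift (S : Set (SymbolicSpace m)) : Prop :=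
  IsClosed S ∧ ∀ u ∈ S, shift u ∈ S

/-- The word formed by the first `n` letters of `u`. -/
def pre (u : SymbolicSpace m) (n : ℕ) : List (Fin m) := List.ofFn (fun i : Fin n => u.letter i)

/-- `Σ^n`: the words of length `n` that are prefixes of elements of `S`. -/
def words (S : Set (SymbolicSpace m)) (n : ℕ) : Set (List (Fin m)) :=
  {w | ∃ u ∈ S, pre u n = w}

/-- `Σ^*`: the union of `Σ^n` over `n ≥ 1`. -/
def language (S : Set (SymbolicSpace m)) : Set (List (Fin m)) :=
  {w | ∃ n : ℕ, 1 ≤ n ∧ w ∈ words S n}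

/-- The specification property: there is one gap length `M` such that any two words `u`, `v` of
the language can be joined by some word of length `M` of the language. -/
def HasSpecification (S : Set (SymbolicSpace m)) : Prop :=
  ∃ M : ℕ, ∀ u ∈ language S, ∀ v ∈ language S, ∃ w ∈ words S M, u ++ w ++ v ∈ language S

/-- Topological entropy `h(S) = lim (log #Σ^n) / n`. The limit exists for every nonempty
subshift, see `tendsto_topEntropy`. -/
def topEntropy (S : Set (SymbolicSpace m)) : ℝ :=
  limUnder atTop (fun n : ℕ => Real.log ((words S n).ncard : ℝ) / (n : ℝ))

theorem words_finite (S : Set (SymbolicSpace m)) (n : ℕ) : (words S n).Finite := by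
  refine (Set.finite_range (fun f : Fin n → Fin m => List.ofFn f)).subset ?_
  rintro w ⟨u, _, rfl⟩
  exact ⟨fun i => u.letter i, rfl⟩

theorem shift_iterate_apply (u : SymbolicSpace m) (i k : ℕ) : (shift^[i] u).letter k = u.letter (i + k) := by
  induction i generalizing u with
  | zero => simp
  | succ n ih => rw [Function.iterate_succ_apply, ih]; simp only [shift]; congr 1; omega

theorem pre_add (u : SymbolicSpace m) (i j : ℕ) :
    pre u (i + j) = pre u i ++ pre (shift^[i] u) j := by
  simp [pre, List.ofFn_add, shift_iterate_apply]

theorem ncard_words_add_le {S : Set (SymbolicSpace m)} (hS : ∀ u ∈ S, shift u ∈ S) (i j : ℕ) :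
    (words S (i + j)).ncard ≤ (words S i).ncard * (words S j).ncard := by
  rw [← Set.ncard_prod]
  have hsub : words S (i + j) ⊆
      (fun p : List (Fin m) × List (Fin m) => p.1 ++ p.2) '' (words S i ×ˢ words S j) := by
    rintro w ⟨u, hu, rfl⟩
    have hit : shift^[i] u ∈ S := by
      clear j
      induction i with
      | zero => simpa
      | succ n ih => rw [Function.iterate_succ_apply']; exact hS _ ih
    exact ⟨(pre u i, pre (shift^[i] u) j), ⟨⟨u, hu, rfl⟩, ⟨_, hit, rfl⟩⟩, (pre_add u i j).symm⟩
  have hfin := (words_finite S i).prod (words_finite S j)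
  exact (Set.ncard_le_ncard hsub (hfin.image _)).trans (Set.ncard_image_le hfin)

theorem tendsto_topEntropy {S : Set (SymbolicSpace m)} (hS : IsSubshift S) (hne : S.Nonempty) :
    Tendsto (fun n : ℕ => Real.log ((words S n).ncard : ℝ) / (n : ℝ)) atTop
      (𝓝 (topEntropy S)) := by
  have hpos : ∀ n, 1 ≤ (words S n).ncard := fun n => by
    obtain ⟨u, hu⟩ := hne
    exact (Set.ncard_pos (words_finite S n)).2 ⟨pre u n, u, hu, rfl⟩
  have hsub : Subadditive (fun n : ℕ => Real.log ((words S n).ncard : ℝ)) := by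
    intro i j
    have hi := hpos i
    have hj := hpos j
    have hij := hpos (i + j)
    rw [← Real.log_mul (by positivity) (by positivity)]
    exact Real.log_le_log (by positivity) (by exact_mod_cast ncard_words_add_le hS.2 i j)
  refine tendsto_nhds_limUnder ⟨hsub.lim, hsub.tendsto_lim ⟨0, ?_⟩⟩
  rintro _ ⟨n, rfl⟩
  have hn : (1 : ℝ) ≤ ((words S n).ncard : ℝ) := by exact_mod_cast hpos n
  exact div_nonneg (Real.log_nonneg hn) (Nat.cast_nonneg n)

variable [NeZero m]

/-- `l_n(ω) = sup {k ≥ 0 : ω_{n+1} = ⋯ = ω_{n+k} = 0}`, possibly infinite: the length of the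
maximal string of zeros with which `σ^n ω` starts. -/
def zeroRun (ω : SymbolicSpace m) (n : ℕ) : ℕ∞ :=
  ⨆ (k : ℕ) (_ : ∀ i < k, ω.letter (n + i) = 0), (k : ℕ∞)

/-- `L_N(ω) = max_{1 ≤ n ≤ N} l_n(ω)`. -/
def maxRun (ω : SymbolicSpace m) (N : ℕ) : ℕ∞ :=
  (Finset.Icc 1 N).sup (zeroRun ω)

/-- `L_N(ω) / (-log_m ψ(N))`, with values in `[0, ∞]`. Only functions `ψ > 0` with `ψ(N) → 0`
matter, for which the denominator is eventually positive. -/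
def ratio (ψ : ℝ → ℝ) (ω : SymbolicSpace m) (N : ℕ) : ℝ≥0∞ :=
  ((maxRun ω N : ℕ∞) : ℝ≥0∞) / ENNReal.ofReal (-Real.logb m (ψ N))

/-- `U_ψ(a, b)`: liminf of the ratio at least `a`, limsup equal to `b`. -/
def levelSet (S : Set (SymbolicSpace m)) (ψ : ℝ → ℝ) (a b : ℝ≥0∞) : Set (SymbolicSpace m) :=
  {ω | ω ∈ S ∧ a ≤ liminf (ratio ψ ω) atTop ∧ limsup (ratio ψ ω) atTop = b}

/-- `U*_ψ(a, b)`: liminf of the ratio equal to `a`, limsup equal to `b`. -/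
def levelSetStar (S : Set (SymbolicSpace m)) (ψ : ℝ → ℝ) (a b : ℝ≥0∞) :
    Set (SymbolicSpace m) :=
  {ω | ω ∈ S ∧ liminf (ratio ψ ω) atTop = a ∧ limsup (ratio ψ ω) atTop = b}

/-- `ψ₀(x) = m^{-x}`. -/
def psiZero (m : ℕ) (x : ℝ) : ℝ := (m : ℝ) ^ (-x)

/-- `liminf L_N(ω) / N`. -/
def lowerL (ω : SymbolicSpace m) : ℝ≥0∞ :=
  liminf (fun N : ℕ => ((maxRun ω N : ℕ∞) : ℝ≥0∞) / (N : ℝ≥0∞)) atTop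

/-- `limsup L_N(ω) / N`. -/
def upperL (ω : SymbolicSpace m) : ℝ≥0∞ :=
  limsup (fun N : ℕ => ((maxRun ω N : ℕ∞) : ℝ≥0∞) / (N : ℝ≥0∞)) atTop

/-- The coefficient `(b(1 - a) - a) / ((1 + b)(b - a))`, which is read as `1` for `a = b = 0`, and
as its limit `0` for `b = ∞`. -/
def dimCoeff (a : ℝ) (b : ℝ≥0∞) : ℝ :=
  open Classical in
  if b = ∞ then 0
  else if a = 0 ∧ b = 0 then 1
  else (b.toReal * (1 - a) - a) / ((1 + b.toReal) * (b.toReal - a))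

end ZeroRuns

end

open ZeroRuns

/-! Both bounds come from the zeros forced inside a prefix by the lower growth rate `a`. Upper
bound. Eventually zero words are countable, so they can be dropped. If the upper rate lies between b
and B, then for infinitely many n a run of length about bn starts at n, right after a nonzero
letter. The longest earlier run has length t ≥ an (up to ε) and ends before n. It starts at some p
with t ≤ Bp, so p ≥ (a/B)n. The letter before p is again nonzero, so the argument repeats inside the
prefix of length p. A proportion a(1 + ρ + ρ² + ⋯), ρ = a/B, of the prefix is thus forced to be
zero, leaving about exp(h n (1 - a/(1 - a/B))) prefixes (`ncard_nestedWords_le`). The final run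
makes the cylinders of diameter m^{-(1+b)n}, and `dimH_le_of_frequently_covered` gives dimension at
most (1 - a/(1 - a/B))/(1 + b) · h/log m. At B = b this is the stated coefficient; B = b + ϱ gives
the last estimate via `coeff_perturb_le`. The inequality p + t ≤ n alone gives emptiness when b <
a/(1 - a). Lower bound. Cut positions into cells of length ℓ + M. Place zero blocks of T_k cells at
cell N_k with T_k/N_k → b and N_k/N_{k+1} → r, where rb = a. Fill every other cell with an arbitrary
nonzero word of Σ^ℓ, glued by specification. All these words have growth rates exactly a and b, and
the free cells have lower density at least (1 - a/(1 - r))/(1 + b). Reading the free cells as base-K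
digits is a Hölder map onto [0, 1] (`le_dimH_of_coding`). Letting ℓ → ∞ turns log K/(ℓ + M) into h.
The case a = b = 0 also gives dim Σ = h/log m. -/

open scoped NNReal

namespace ZeroRuns

open Filter Topology ENNReal MeasureTheory

/-! ### Prefixes and the metric. -/

section Basic

variable {m : ℕ}

theorem pre_length (u : SymbolicSpace m) (n : ℕ) : (pre u n).length = n := by simp [pre]

theorem pre_getElem (u : SymbolicSpace m) (n i : ℕ) (h : i < (pre u n).length) :
    (pre u n)[i] = u.letter i := by simp [pre]

theorem pre_eq_iff {u v : SymbolicSpace m} {n : ℕ} :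
    pre u n = pre v n ↔ ∀ i < n, u.letter i = v.letter i := by
  constructor
  · intro h i hi
    have h1 := pre_getElem u n i (by rwa [pre_length])
    have h2 := pre_getElem v n i (by rwa [pre_length])
    rw [← h1, ← h2]
    simp only [h]
  · intro h
    simp only [pre, List.ofFn_inj]
    funext i
    exact h i i.2

theorem inv_cast_nonneg : (0 : ℝ) ≤ (m : ℝ)⁻¹ := by positivity

theorem dist_le_of_agree {u v : SymbolicSpace m} {n : ℕ}
    (h : ∀ i < n, u.letter i = v.letter i) : dist u v ≤ ((m : ℝ)⁻¹) ^ n := by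
  have h1 : (1 : ℝ) ≤ (m : ℝ) := by exact_mod_cast one_le_of_word u
  change symDist u v ≤ _
  by_cases huv : u = v
  · subst huv
    rw [symDist_self]
    positivity
  · simp only [symDist, huv, if_false]
    refine pow_le_pow_of_le_one inv_cast_nonneg (inv_le_one_of_one_le₀ h1) ?_
    by_contra! hlt
    have hne : u.letter ≠ v.letter := fun h => huv (SymbolicSpace.ext h)
    exact PiNat.apply_firstDiff_ne hne (h _ (by omega))

theorem exists_dist_eq {u v : SymbolicSpace m} (huv : u ≠ v) :
    ∃ n : ℕ, dist u v = ((m : ℝ)⁻¹) ^ (n + 1) ∧ ∀ i < n, u.letter i = v.letter i := by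
  refine ⟨PiNat.firstDiff (E := fun _ : ℕ => Fin m) u.letter v.letter, ?_, ?_⟩
  · change symDist u v = _
    simp only [symDist, huv, if_false]
  · intro i hi
    exact PiNat.apply_eq_of_lt_firstDiff hi

theorem ediam_le_of_agree {A : Set (SymbolicSpace m)} {n : ℕ}
    (h : ∀ u ∈ A, ∀ v ∈ A, ∀ i < n, u.letter i = v.letter i) :
    Metric.ediam A ≤ ENNReal.ofReal (((m : ℝ)⁻¹) ^ n) := by
  refine Metric.ediam_le fun u hu v hv => ?_
  rw [edist_dist]
  exact ENNReal.ofReal_le_ofReal (dist_le_of_agree (h u hu v hv))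

theorem shift_iterate_mem {S : Set (SymbolicSpace m)} (hS : ∀ u ∈ S, shift u ∈ S)
    {u : SymbolicSpace m} (hu : u ∈ S) (n : ℕ) : shift^[n] u ∈ S := by
  induction n with
  | zero => simpa
  | succ n ih => rw [Function.iterate_succ_apply']; exact hS _ ih

end Basic

/-! ### Zero runs and their growth rates. -/

section Runs

variable {m : ℕ} [NeZero m]

theorem le_zeroRun_iff {ω : SymbolicSpace m} {n k : ℕ} :
    (k : ℕ∞) ≤ zeroRun ω n ↔ ∀ i < k, ω.letter (n + i) = 0 := by
  constructor
  · intro h i hi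
    by_contra hne
    have : zeroRun ω n ≤ i := by
      refine iSup₂_le fun k' hk' => ?_
      by_contra! hlt
      exact hne (hk' i (by exact_mod_cast hlt))
    have := h.trans this
    norm_cast at this
    omega
  · intro h
    exact le_iSup₂ (f := fun (k : ℕ) (_ : ∀ i < k, ω.letter (n + i) = 0) => (k : ℕ∞)) k h

theorem zeroRun_lt_top {ω : SymbolicSpace m} (hω : ∀ n, ∃ i, n ≤ i ∧ ω.letter i ≠ 0) (n : ℕ) :
    zeroRun ω n ≠ ⊤ := by
  intro htop
  obtain ⟨i, hi, hne⟩ := hω n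
  have : ((i - n + 1 : ℕ) : ℕ∞) ≤ zeroRun ω n := by rw [htop]; exact le_top
  have := le_zeroRun_iff.1 this (i - n) (by omega)
  rw [show n + (i - n) = i by omega] at this
  exact hne this

theorem zeroRun_le_maxRun {ω : SymbolicSpace m} {n N : ℕ} (h1 : 1 ≤ n) (h2 : n ≤ N) :
    zeroRun ω n ≤ maxRun ω N :=
  Finset.le_sup (f := zeroRun ω) (Finset.mem_Icc.2 ⟨h1, h2⟩)

theorem maxRun_le_iff {ω : SymbolicSpace m} {N : ℕ} {k : ℕ∞} :
    maxRun ω N ≤ k ↔ ∀ n, 1 ≤ n → n ≤ N → zeroRun ω n ≤ k := by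
  simp [maxRun, Finset.sup_le_iff]

theorem maxRun_mono (ω : SymbolicSpace m) : Monotone (maxRun ω) := fun _ _ h =>
  Finset.sup_mono (Finset.Icc_subset_Icc_right h)

/-- The longest run is attained at a position which starts a maximal string of zeros. -/
theorem exists_run_start (ω : SymbolicSpace m) {N : ℕ} (hN : 1 ≤ N) :
    ∃ n, 1 ≤ n ∧ n ≤ N ∧ zeroRun ω n = maxRun ω N ∧ (n = 1 ∨ ω.letter (n - 1) ≠ 0) := by
  classical
  have hex : ∃ n, 1 ≤ n ∧ n ≤ N ∧ zeroRun ω n = maxRun ω N := by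
    obtain ⟨n, hn, h⟩ := Finset.exists_mem_eq_sup (Finset.Icc 1 N) ⟨1, by simp [hN]⟩ (zeroRun ω)
    rw [Finset.mem_Icc] at hn
    exact ⟨n, hn.1, hn.2, h.symm⟩
  obtain ⟨h1, h2, h3⟩ := Nat.find_spec hex
  refine ⟨Nat.find hex, h1, h2, h3, ?_⟩
  by_contra! hcon
  obtain ⟨hne, hzero⟩ := hcon
  set n := Nat.find hex with hn
  -- The least maximising position works: if the letter before it were zero, position n - 1 would
  -- carry a run at least as long.
  refine Nat.find_min hex (m := n - 1) (by omega) ⟨by omega, by omega, ?_⟩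
  refine le_antisymm (zeroRun_le_maxRun (by omega) (by omega)) ?_
  rw [← h3]
  refine ENat.forall_natCast_le_iff_le.1 fun k hk => ?_
  rw [le_zeroRun_iff] at hk ⊢
  intro i hi
  rcases Nat.eq_zero_or_pos i with rfl | hpos
  · simpa using hzero
  · have := hk (i - 1) (by omega)
    rwa [show n + (i - 1) = n - 1 + i by omega] at this

theorem ratio_psiZero (hm : 2 ≤ m) (ω : SymbolicSpace m) (N : ℕ) :
    ratio (psiZero m) ω N = ((maxRun ω N : ℕ∞) : ℝ≥0∞) / (N : ℝ≥0∞) := by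
  have h1 : (1 : ℝ) < m := by exact_mod_cast hm
  simp only [ratio, psiZero]
  rw [Real.logb_rpow (by linarith) (by linarith), neg_neg, ENNReal.ofReal_natCast]

theorem ratio_eq_coe {ω : SymbolicSpace m} {N k : ℕ} (hN : 1 ≤ N) (h : maxRun ω N = k) :
    ((maxRun ω N : ℕ∞) : ℝ≥0∞) / (N : ℝ≥0∞) = ENNReal.ofReal ((k : ℝ) / N) := by
  have : (0 : ℝ) < N := by exact_mod_cast hN
  rw [h, ENNReal.ofReal_div_of_pos this, ENNReal.ofReal_natCast, ENNReal.ofReal_natCast]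
  simp

theorem eventually_le_of_lt_lowerL {ω : SymbolicSpace m} {a : ℝ} (h : ENNReal.ofReal a < lowerL ω) :
    ∀ᶠ N : ℕ in atTop, ∀ k : ℕ, maxRun ω N = k → a * N ≤ k := by
  filter_upwards [eventually_lt_of_lt_liminf h, eventually_ge_atTop 1] with N hN h1 k hk
  have : (0 : ℝ) < N := by exact_mod_cast h1
  rw [ratio_eq_coe h1 hk, ENNReal.ofReal_lt_ofReal_iff'] at hN
  exact ((lt_div_iff₀ this).1 hN.1).le

theorem eventually_le_of_upperL_lt {ω : SymbolicSpace m} {b : ℝ} (h : upperL ω < ENNReal.ofReal b) :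
    ∀ᶠ N : ℕ in atTop, ∀ k : ℕ, maxRun ω N = k → (k : ℝ) ≤ b * N := by
  filter_upwards [eventually_lt_of_limsup_lt h, eventually_ge_atTop 1] with N hN h1 k hk
  have : (0 : ℝ) < N := by exact_mod_cast h1
  rw [ratio_eq_coe h1 hk, ENNReal.ofReal_lt_ofReal_iff'] at hN
  exact ((div_lt_iff₀ this).1 hN.1).le

theorem frequently_le_of_lt_upperL {ω : SymbolicSpace m} {b : ℝ} (h : ENNReal.ofReal b < upperL ω) :
    ∃ᶠ N : ℕ in atTop, ∀ k : ℕ, maxRun ω N = k → b * N ≤ k := by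
  refine ((frequently_lt_of_lt_limsup (by isBoundedDefault) h).and_eventually
    (eventually_ge_atTop 1)).mono ?_
  rintro N ⟨hN, h1⟩ k hk
  have : (0 : ℝ) < N := by exact_mod_cast h1
  rw [ratio_eq_coe h1 hk, ENNReal.ofReal_lt_ofReal_iff'] at hN
  exact ((lt_div_iff₀ this).1 hN.1).le

/-- A word with infinitely many nonzero letters. -/
def NotEventuallyZero (ω : SymbolicSpace m) : Prop := ∀ n, ∃ i, n ≤ i ∧ ω.letter i ≠ 0

theorem countable_eventuallyZero : {ω : SymbolicSpace m | ¬ NotEventuallyZero ω}.Countable := by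
  have : {ω : SymbolicSpace m | ¬ NotEventuallyZero ω} ⊆
      Set.range (fun l : List (Fin m) => (⟨fun i => l.getD i 0⟩ : SymbolicSpace m)) := by
    intro ω hω
    simp only [NotEventuallyZero, Set.mem_ofPred_eq, not_forall, not_exists, not_and, not_not] at hω
    obtain ⟨n, hn⟩ := hω
    refine ⟨pre ω n, ?_⟩
    ext i
    by_cases hi : i < n
    · simp [List.getD, pre, hi]
    · simp [List.getD, pre, hi, hn i (by omega)]
  exact (Set.countable_range _).mono this

theorem NotEventuallyZero.exists_maxRun {ω : SymbolicSpace m} (hω : NotEventuallyZero ω) (N : ℕ) :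
    ∃ k : ℕ, maxRun ω N = k := by
  have : maxRun ω N ≠ ⊤ := by
    have : maxRun ω N < ⊤ := by
      rw [maxRun, Finset.sup_lt_iff (by simp)]
      intro n _
      exact lt_top_iff_ne_top.2 (zeroRun_lt_top hω n)
    exact this.ne
  exact ⟨(maxRun ω N).toNat, (ENat.natCast_toNat this).symm⟩

end Runs

/-! ### A Cantelli-type covering bound for the dimension. -/

section Cover

variable {m : ℕ} [NeZero m]

/-- A prefix of length n followed by t n zeros determines n + t n letters, so its cylinder has
diameter at most m^{-(n + t n)}. The levels from N on cover E for every N, and their s-sums stay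
below the full convergent series; hence the s-dimensional measure is finite, which suffices. -/
theorem dimH_le_of_frequently_covered (hm : 2 ≤ m) {E : Set (SymbolicSpace m)}
    (P : ℕ → Set (List (Fin m))) (hP : ∀ n, (P n).Finite) (t : ℕ → ℕ) (s : ℝ≥0)
    (hsum : Summable fun n : ℕ => ((P n).ncard : ℝ) * ((m : ℝ)⁻¹) ^ ((s : ℝ) * (n + t n)))
    (hE : ∀ ω ∈ E, ∃ᶠ n in atTop, pre ω n ∈ P n ∧ ∀ i < t n, ω.letter (n + i) = 0) :
    dimH E ≤ s := by
  borelize (SymbolicSpace m)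
  have hm1 : (1 : ℝ) < m := by exact_mod_cast hm
  have hi1 : (m : ℝ)⁻¹ < 1 := inv_lt_one_of_one_lt₀ hm1
  apply dimH_le_of_hausdorffMeasure_ne_top
  -- The N-th cover uses levels n + N only, so its diameters tend to 0 with N.
  let A : ∀ N : ℕ, (Σ n : ℕ, P (n + N)) → Set (SymbolicSpace m) := fun N i =>
    {ω | pre ω (i.1 + N) = i.2.1 ∧ ∀ j < t (i.1 + N), ω.letter (i.1 + N + j) = 0}
  have hdiam : ∀ N i, Metric.ediam (A N i) ≤
      ENNReal.ofReal (((m : ℝ)⁻¹) ^ (i.1 + N + t (i.1 + N))) := by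
    intro N i
    refine ediam_le_of_agree ?_
    rintro u ⟨hu1, hu2⟩ v ⟨hv1, hv2⟩ j hj
    by_cases hlt : j < i.1 + N
    · exact pre_eq_iff.1 (hu1.trans hv1.symm) j hlt
    · have e1 := hu2 (j - (i.1 + N)) (by omega)
      have e2 := hv2 (j - (i.1 + N)) (by omega)
      rw [show i.1 + N + (j - (i.1 + N)) = j by omega] at e1 e2
      rw [e1, e2]
  have hbound := Measure.hausdorffMeasure_le_liminf_tsum (X := SymbolicSpace m)
    (ι := fun N : ℕ => Σ n : ℕ, P (n + N)) (s : ℝ) E (l := atTop)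
    (fun N => ENNReal.ofReal (((m : ℝ)⁻¹) ^ N)) ?_ A ?_ ?_
  rotate_left
  · rw [← ENNReal.ofReal_zero]
    exact ENNReal.tendsto_ofReal (tendsto_pow_atTop_nhds_zero_of_lt_one inv_cast_nonneg hi1)
  · refine Eventually.of_forall fun N i => (hdiam N i).trans (ENNReal.ofReal_le_ofReal ?_)
    exact pow_le_pow_of_le_one inv_cast_nonneg hi1.le (by omega)
  · refine Eventually.of_forall fun N ω hω => ?_
    obtain ⟨n, hn, h1, h2⟩ := frequently_atTop.1 (hE ω hω) N
    obtain ⟨k, rfl⟩ := Nat.exists_eq_add_of_le' hn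
    exact Set.mem_iUnion.2 ⟨⟨k, ⟨pre ω (k + N), h1⟩⟩, rfl, h2⟩
  have hle : ∀ N : ℕ, ∑' i, Metric.ediam (A N i) ^ (s : ℝ) ≤
      ENNReal.ofReal (∑' n : ℕ, ((P n).ncard : ℝ) * ((m : ℝ)⁻¹) ^ ((s : ℝ) * (n + t n))) := by
    intro N
    rw [ENNReal.tsum_sigma', ENNReal.ofReal_tsum_of_nonneg (fun n => by positivity) hsum]
    refine le_trans ?_ (ENNReal.tsum_comp_le_tsum_of_injective (add_left_injective N) _)
    refine ENNReal.tsum_le_tsum fun n => ?_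
    have : ∀ w : P (n + N), Metric.ediam (A N ⟨n, w⟩) ^ (s : ℝ) ≤
        ENNReal.ofReal (((m : ℝ)⁻¹) ^ ((s : ℝ) * ((n + N : ℕ) + t (n + N)))) := by
      intro w
      refine (ENNReal.rpow_le_rpow (hdiam N ⟨n, w⟩) s.coe_nonneg).trans ?_
      rw [ENNReal.ofReal_rpow_of_nonneg (by positivity) s.coe_nonneg]
      refine ENNReal.ofReal_le_ofReal (le_of_eq ?_)
      rw [← Real.rpow_natCast, ← Real.rpow_mul inv_cast_nonneg]
      congr 1
      push_cast
      ring
    refine (ENNReal.tsum_le_tsum this).trans ?_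
    rw [ENNReal.tsum_const, ENNReal.ofReal_mul (by positivity), ENNReal.ofReal_natCast,
      Set.coe_eq_subtype, ENat.card_coe_set_eq, ← (hP (n + N)).cast_ncard_eq]
    simp
  have hfin := hbound.trans (liminf_le_of_frequently_le' (Eventually.of_forall hle).frequently)
  exact (hfin.trans_lt ENNReal.ofReal_lt_top).ne

end Cover

/-! ### Counting prefixes that contain nested zero runs. -/

section Counting

variable {m : ℕ} [NeZero m]

omit [NeZero m] in
-- The constant absorbs the finitely many short lengths. A bound valid for every length is needed
-- because the pieces of a prefix between runs can be short.
theorem exists_ncard_words_le {S : Set (SymbolicSpace m)} (hS : IsSubshift S) (hne : S.Nonempty)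
    {η : ℝ} (hη : topEntropy S < η) (hη0 : 0 ≤ η) :
    ∃ C : ℝ, 1 ≤ C ∧ ∀ n : ℕ, ((words S n).ncard : ℝ) ≤ C * Real.exp (η * n) := by
  have hev : ∀ᶠ n : ℕ in atTop, ((words S n).ncard : ℝ) ≤ Real.exp (η * n) := by
    filter_upwards [(tendsto_topEntropy hS hne).eventually_lt_const hη, eventually_ge_atTop 1]
      with n hn h1
    have hn0 : (0 : ℝ) < n := by exact_mod_cast h1
    have hpos : (0 : ℝ) < (words S n).ncard := by
      obtain ⟨u, hu⟩ := hne
      exact_mod_cast (Set.ncard_pos (words_finite S n)).2 ⟨pre u n, u, hu, rfl⟩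
    rw [← Real.log_le_iff_le_exp hpos]
    exact ((div_lt_iff₀ hn0).1 hn).le
  obtain ⟨n₀, hn₀⟩ := eventually_atTop.1 hev
  refine ⟨1 + ∑ i ∈ Finset.range n₀, ((words S i).ncard : ℝ), ?_, fun n => ?_⟩
  · have : 0 ≤ ∑ i ∈ Finset.range n₀, ((words S i).ncard : ℝ) := by positivity
    linarith
  · have he : 1 ≤ Real.exp (η * n) := Real.one_le_exp (by positivity)
    have hsum : 0 ≤ ∑ i ∈ Finset.range n₀, ((words S i).ncard : ℝ) := by positivity
    rcases le_or_gt n₀ n with h | h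
    · have := hn₀ n h
      nlinarith
    · have : ((words S n).ncard : ℝ) ≤ ∑ i ∈ Finset.range n₀, ((words S i).ncard : ℝ) :=
        Finset.single_le_sum (f := fun i => ((words S i).ncard : ℝ)) (fun i _ => by positivity)
          (Finset.mem_range.2 h)
      nlinarith

/-- The prefix of length `n` of `ω` contains `J` successive strings of zeros, the last of which
has length at least `α n` and starts at a position `p ≥ ρ n`, and so on inside the prefix of
length `p`. -/
def NestedRuns (α ρ : ℝ) : ℕ → SymbolicSpace m → ℕ → Prop
  | 0, _, _ => True
  | J + 1, ω, n => ∃ p t : ℕ, p + t ≤ n ∧ α * n ≤ t ∧ ρ * n ≤ p ∧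
      (∀ i < t, ω.letter (p + i) = 0) ∧ NestedRuns α ρ J ω p

/-- The guaranteed proportion of zeros that come from `J` nested runs. -/
def runDensity (α ρ : ℝ) (J : ℕ) : ℝ := α * ∑ j ∈ Finset.range J, ρ ^ j

theorem runDensity_succ (α ρ : ℝ) (J : ℕ) :
    runDensity α ρ (J + 1) = α + ρ * runDensity α ρ J := by
  simp only [runDensity, Finset.sum_range_succ', pow_succ, pow_zero, ← Finset.sum_mul]
  ring

theorem runDensity_nonneg {α ρ : ℝ} (hα : 0 ≤ α) (hρ : 0 ≤ ρ) (J : ℕ) : 0 ≤ runDensity α ρ J := by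
  unfold runDensity
  positivity

/-- The prefixes of length `n` with `J` nested runs. -/
def nestedWords (S : Set (SymbolicSpace m)) (α ρ : ℝ) (J n : ℕ) : Set (List (Fin m)) :=
  {w | ∃ u ∈ S, NestedRuns α ρ J u n ∧ pre u n = w}

theorem nestedWords_subset (S : Set (SymbolicSpace m)) (α ρ : ℝ) (J n : ℕ) :
    nestedWords S α ρ J n ⊆ words S n := fun _ ⟨u, hu, _, h⟩ => ⟨u, hu, h⟩

theorem nestedWords_finite (S : Set (SymbolicSpace m)) (α ρ : ℝ) (J n : ℕ) :
    (nestedWords S α ρ J n).Finite := (words_finite S n).subset (nestedWords_subset S α ρ J n)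

theorem pre_eq_replicate {u : SymbolicSpace m} {p t : ℕ} (h : ∀ i < t, u.letter (p + i) = 0) :
    pre (shift^[p] u) t = List.replicate t 0 := by
  refine List.ext_getElem (by simp [pre_length]) fun i h1 h2 => ?_
  rw [pre_getElem, shift_iterate_apply, List.getElem_replicate]
  exact h i (by rwa [pre_length] at h1)

/-- Split the prefix as x 0^t y with |x| = p carrying J runs. There are at most (n + 1)² pairs (p,
t). With σ the density for J runs, the exponent is (1 - σ)p + (n - p - t) = n - t - σp ≤ (1 - α -
ρσ)n, which is the recursion of `runDensity`. -/
theorem ncard_nestedWords_le {S : Set (SymbolicSpace m)} (hS : ∀ u ∈ S, shift u ∈ S)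
    {α ρ η C : ℝ} (hα : 0 ≤ α) (hρ : 0 ≤ ρ) (hη : 0 ≤ η) (hC1 : 1 ≤ C)
    (hC : ∀ n : ℕ, ((words S n).ncard : ℝ) ≤ C * Real.exp (η * n)) (J n : ℕ) :
    ((nestedWords S α ρ J n).ncard : ℝ) ≤
      C ^ (J + 1) * ((n : ℝ) + 1) ^ (2 * J) * Real.exp (η * ((1 - runDensity α ρ J) * n)) := by
  induction J generalizing n with
  | zero =>
    have := Set.ncard_le_ncard (nestedWords_subset S α ρ 0 n) (words_finite S n)
    have h2 : ((nestedWords S α ρ 0 n).ncard : ℝ) ≤ (words S n).ncard := by exact_mod_cast this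
    simpa [runDensity] using h2.trans (hC n)
  | succ J ih =>
    set σ := runDensity α ρ J with hσ
    have hσ0 : 0 ≤ σ := runDensity_nonneg hα hρ J
    -- The constraints on (p, t) are part of the set, so inadmissible pairs contribute the empty
    -- set.
    let B : Fin (n + 1) × Fin (n + 1) → Set (List (Fin m)) := fun q =>
      {w | ((q.1 : ℕ) + q.2 ≤ n ∧ α * n ≤ (q.2 : ℕ) ∧ ρ * n ≤ (q.1 : ℕ)) ∧
        w ∈ (fun x : List (Fin m) × List (Fin m) => x.1 ++ List.replicate (q.2 : ℕ) 0 ++ x.2) ''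
          (nestedWords S α ρ J q.1 ×ˢ words S (n - (q.1 + q.2)))}
    have hsub : nestedWords S α ρ (J + 1) n ⊆ ⋃ q, B q := by
      rintro w ⟨u, hu, ⟨p, t, hpt, ht, hp, hz, hn⟩, rfl⟩
      refine Set.mem_iUnion.2 ⟨(⟨p, by omega⟩, ⟨t, by omega⟩), ⟨hpt, ht, hp⟩,
        (pre u p, pre (shift^[p + t] u) (n - (p + t))), ⟨⟨u, hu, hn, rfl⟩,
          ⟨_, shift_iterate_mem hS hu _, rfl⟩⟩, ?_⟩
      simp only
      rw [← pre_eq_replicate hz, ← pre_add, ← pre_add, Nat.add_sub_cancel' hpt]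
    have hBfin : ∀ q, (B q).Finite := fun q =>
      (((nestedWords_finite S α ρ J q.1).prod (words_finite S _)).image _).subset fun w hw => hw.2
    have hB : ∀ q, ((B q).ncard : ℝ) ≤ C ^ (J + 2) * ((n : ℝ) + 1) ^ (2 * J) *
        Real.exp (η * ((1 - runDensity α ρ (J + 1)) * n)) := by
      rintro ⟨⟨p, hp'⟩, ⟨t, ht'⟩⟩
      by_cases hcond : p + t ≤ n ∧ α * n ≤ (t : ℕ) ∧ ρ * n ≤ (p : ℕ)
      · obtain ⟨hpt, ht, hp⟩ := hcond
        have h1 : (B (⟨p, hp'⟩, ⟨t, ht'⟩)).ncard ≤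
            (nestedWords S α ρ J p).ncard * (words S (n - (p + t))).ncard := by
          rw [← Set.ncard_prod]
          have hfin := (nestedWords_finite S α ρ J p).prod (words_finite S (n - (p + t)))
          exact (Set.ncard_le_ncard (fun w hw => hw.2) (hfin.image _)).trans (Set.ncard_image_le hfin)
        have h2 : ((B (⟨p, hp'⟩, ⟨t, ht'⟩)).ncard : ℝ) ≤
            (nestedWords S α ρ J p).ncard * (words S (n - (p + t))).ncard := by exact_mod_cast h1
        have hpn : (p : ℝ) ≤ n := by exact_mod_cast (by omega : p ≤ n)
        calc ((B (⟨p, hp'⟩, ⟨t, ht'⟩)).ncard : ℝ)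
            ≤ (nestedWords S α ρ J p).ncard * (words S (n - (p + t))).ncard := h2
          _ ≤ (C ^ (J + 1) * ((p : ℝ) + 1) ^ (2 * J) * Real.exp (η * ((1 - σ) * p))) *
              (C * Real.exp (η * ((n - (p + t) : ℕ) : ℝ))) := by
              gcongr
              · exact ih p
              · exact hC _
          _ = C ^ (J + 2) * ((p : ℝ) + 1) ^ (2 * J) *
              Real.exp (η * ((1 - σ) * p) + η * ((n : ℝ) - (p + t))) := by
              rw [Real.exp_add, Nat.cast_sub hpt]
              push_cast
              ring
          _ ≤ _ := by
              gcongr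
              rw [← mul_add]
              gcongr
              rw [runDensity_succ, ← hσ]
              nlinarith [mul_le_mul_of_nonneg_left hp hσ0]
      · have : B (⟨p, hp'⟩, ⟨t, ht'⟩) = ∅ := by
          ext w
          simp only [B, Set.mem_empty_iff_false, iff_false]
          exact fun hw => hcond hw.1
        rw [this, Set.ncard_empty]
        simp only [Nat.cast_zero]
        positivity
    have h1 : (nestedWords S α ρ (J + 1) n).ncard ≤ ∑ q, (B q).ncard :=
      (Set.ncard_le_ncard hsub (Set.finite_iUnion hBfin)).trans (Set.ncard_iUnion_le_of_fintype B)
    have h2 : ((nestedWords S α ρ (J + 1) n).ncard : ℝ) ≤ ∑ q, ((B q).ncard : ℝ) := by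
      exact_mod_cast h1
    refine (h2.trans (Finset.sum_le_sum fun q _ => hB q)).trans (le_of_eq ?_)
    rw [Finset.sum_const, Finset.card_univ, Fintype.card_prod, Fintype.card_fin, nsmul_eq_mul]
    push_cast
    ring

theorem summable_poly_mul_exp (k : ℕ) {δ : ℝ} (hδ : 0 < δ) :
    Summable fun n : ℕ => ((n : ℝ) + 1) ^ k * Real.exp (-(δ * n)) := by
  have h1 : ‖Real.exp (-δ)‖ < 1 := by
    rw [Real.norm_eq_abs, abs_of_pos (Real.exp_pos _)]
    simpa using hδ
  have h2 : Summable fun n : ℕ => ((n + 1 : ℕ) : ℝ) ^ k * Real.exp (-δ) ^ (n + 1) :=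
    (summable_nat_add_iff (f := fun n : ℕ => (n : ℝ) ^ k * Real.exp (-δ) ^ n) 1).2
      (summable_pow_mul_geometric_of_norm_lt_one k h1)
  refine (h2.mul_left (Real.exp δ)).congr fun n => ?_
  have h3 : Real.exp (-(δ * n)) = Real.exp δ * Real.exp (-δ) ^ (n + 1) := by
    rw [← Real.exp_nat_mul, ← Real.exp_add]
    congr 1
    push_cast
    ring
  rw [h3]
  push_cast
  ring

/-- The strict inequality `hd` leaves a factor exp(-δn) in the covering sum, which beats the
polynomial from the choice of run positions. -/
theorem dimH_nestedRuns_le (hm : 2 ≤ m) {S : Set (SymbolicSpace m)} (hS : IsSubshift S)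
    (hne : S.Nonempty) {α ρ η b : ℝ} (hα : 0 ≤ α) (hρ : 0 ≤ ρ) (hη : topEntropy S < η)
    (hη0 : 0 ≤ η) (J : ℕ) {d : ℝ≥0}
    (hd : η * (1 - runDensity α ρ J) < d * ((1 + b) * Real.log m)) :
    dimH {ω | ω ∈ S ∧ ∃ᶠ n : ℕ in atTop, NestedRuns α ρ J ω n ∧
      ∀ i < ⌈b * n⌉₊, ω.letter (n + i) = 0} ≤ d := by
  obtain ⟨C, hC1, hC⟩ := exists_ncard_words_le hS hne hη hη0
  have hm0 : (0 : ℝ) < m := by exact_mod_cast (by omega : 0 < m)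
  have hlog : 0 < Real.log m := Real.log_pos (by exact_mod_cast hm)
  refine dimH_le_of_frequently_covered hm (nestedWords S α ρ J)
    (nestedWords_finite S α ρ J) (fun n => ⌈b * n⌉₊) d ?_ ?_
  · set δ := d * ((1 + b) * Real.log m) - η * (1 - runDensity α ρ J) with hδ
    have hδ0 : 0 < δ := by linarith
    refine Summable.of_nonneg_of_le (fun n => by positivity) (fun n => ?_)
      ((summable_poly_mul_exp (2 * J) hδ0).mul_left (C ^ (J + 1)))
    have hexp : ((m : ℝ)⁻¹) ^ ((d : ℝ) * (n + (⌈b * n⌉₊ : ℕ))) ≤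
        Real.exp (-(d * ((1 + b) * Real.log m) * n)) := by
      rw [Real.rpow_def_of_pos (by positivity), Real.log_inv, Real.exp_le_exp]
      have h1 : b * n ≤ (⌈b * n⌉₊ : ℕ) := Nat.le_ceil _
      have h2 : 0 ≤ Real.log m * d := by positivity
      nlinarith [mul_le_mul_of_nonneg_left h1 h2]
    calc ((nestedWords S α ρ J n).ncard : ℝ) * ((m : ℝ)⁻¹) ^ ((d : ℝ) * (n + (⌈b * n⌉₊ : ℕ)))
        ≤ (C ^ (J + 1) * ((n : ℝ) + 1) ^ (2 * J) * Real.exp (η * ((1 - runDensity α ρ J) * n))) *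
          Real.exp (-(d * ((1 + b) * Real.log m) * n)) := by
          gcongr
          exact ncard_nestedWords_le hS.2 hα hρ hη0 hC1 hC J n
      _ = C ^ (J + 1) * (((n : ℝ) + 1) ^ (2 * J) * Real.exp (-(δ * n))) := by
          rw [mul_assoc, mul_assoc, ← Real.exp_add, hδ]
          ring_nf
  · rintro ω ⟨hω, hfreq⟩
    exact hfreq.mono fun n hn => ⟨⟨ω, hω, hn.1, rfl⟩, hn.2⟩

end Counting

/-! ### Forced runs inside prefixes. -/

section Dynamics

variable {m : ℕ} [NeZero m]

/-- A maximal string of zeros ending before a nonzero letter at position `n - 1`. -/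
theorem exists_run_before {ω : SymbolicSpace m} (hω : NotEventuallyZero ω) {n : ℕ} (hn : 2 ≤ n)
    (hlast : ω.letter (n - 1) ≠ 0) :
    ∃ p t : ℕ, 1 ≤ p ∧ p + t ≤ n ∧ maxRun ω (n - 1) = t ∧ maxRun ω p = t ∧
      (∀ i < t, ω.letter (p + i) = 0) ∧ (p = 1 ∨ ω.letter (p - 1) ≠ 0) := by
  obtain ⟨p, hp1, hpn, hrun, hstart⟩ := exists_run_start ω (N := n - 1) (by omega)
  obtain ⟨t, ht⟩ := hω.exists_maxRun (n - 1)
  have hz : ∀ i < t, ω.letter (p + i) = 0 := by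
    rw [← le_zeroRun_iff, hrun, ht]
  refine ⟨p, t, hp1, ?_, ht, ?_, hz, hstart⟩
  · by_contra! hlt
    have := hz (n - 1 - p) (by omega)
    rw [show p + (n - 1 - p) = n - 1 by omega] at this
    exact hlast this
  · refine le_antisymm (ht ▸ maxRun_mono ω hpn) ?_
    rw [← ht, ← hrun]
    exact zeroRun_le_maxRun hp1 le_rfl

/-- The run realising a large L_N starts at some n ≤ N, so its length is also at least bn. These n
are unbounded because the runs starting up to any fixed position have bounded length. -/
theorem frequently_long_run {ω : SymbolicSpace m} (hω : NotEventuallyZero ω) {b : ℝ} (hb : 0 < b)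
    (h : ENNReal.ofReal b < upperL ω) :
    ∃ᶠ n : ℕ in atTop, ω.letter (n - 1) ≠ 0 ∧ ∀ i < ⌈b * n⌉₊, ω.letter (n + i) = 0 := by
  rw [frequently_atTop]
  intro R
  obtain ⟨K, hK⟩ := hω.exists_maxRun (R + 1)
  -- Past K/b the longest run exceeds K, the longest run starting at or before R + 1; hence it
  -- starts after R + 1.
  obtain ⟨N₁, hN₁⟩ := exists_nat_gt ((K : ℝ) / b)
  obtain ⟨N, hN, hbN⟩ := frequently_atTop.1 (frequently_le_of_lt_upperL h) (N₁ + 1)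
  obtain ⟨k, hk⟩ := hω.exists_maxRun N
  obtain ⟨n, hn1, hnN, hrun, hstart⟩ := exists_run_start ω (N := N) (by omega)
  have hbk := hbN k hk
  have hKk : K < k := by
    rw [div_lt_iff₀ hb] at hN₁
    have : (N₁ : ℝ) ≤ N := by exact_mod_cast (by omega : N₁ ≤ N)
    have : (K : ℝ) < k := by nlinarith
    exact_mod_cast this
  have hnR : R + 1 < n := by
    by_contra! hle
    have := zeroRun_le_maxRun (ω := ω) hn1 hle
    rw [hrun, hk, hK] at this
    norm_cast at this
    omega
  refine ⟨n, by omega, hstart.resolve_left (by omega), fun i hi => ?_⟩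
  have hz : ∀ i < k, ω.letter (n + i) = 0 := by rw [← le_zeroRun_iff, hrun, hk]
  refine hz i (hi.trans_le ?_)
  rw [Nat.ceil_le]
  have : (n : ℝ) ≤ N := by exact_mod_cast hnN
  nlinarith

/-- The run is the longest one starting before n; it stops before the nonzero letter at n - 1. It is
also the longest starting up to p, so the upper rate at p yields t ≤ Bp. -/
theorem exists_threshold_run {ω : SymbolicSpace m} (hω : NotEventuallyZero ω) {α a B : ℝ}
    (hα : 0 ≤ α) (hαa : α < a)
    (hlow : ENNReal.ofReal a < lowerL ω) (hup : upperL ω < ENNReal.ofReal B) :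
    ∃ R : ℕ, 2 ≤ R ∧ ∀ n ≥ R, ω.letter (n - 1) ≠ 0 → ∃ p t : ℕ, p + t ≤ n ∧ 1 ≤ p ∧ α * n ≤ t ∧
      (t : ℝ) ≤ B * p ∧ (∀ i < t, ω.letter (p + i) = 0) ∧ (p = 1 ∨ ω.letter (p - 1) ≠ 0) := by
  obtain ⟨R₁, h₁⟩ := eventually_atTop.1 (eventually_le_of_lt_lowerL hlow)
  obtain ⟨R₂, h₂⟩ := eventually_atTop.1 (eventually_le_of_upperL_lt hup)
  obtain ⟨K, hK⟩ := hω.exists_maxRun R₂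
  obtain ⟨R₃, h₃⟩ := exists_nat_gt ((a + K) / (a - α))
  have hpos : 0 < a - α := by linarith
  rw [div_lt_iff₀ hpos] at h₃
  refine ⟨R₁ + R₃ + 2, by omega, fun n hn hlast => ?_⟩
  obtain ⟨p, t, hp1, hpt, ht, htp, hz, hstart⟩ := exists_run_before hω (by omega) hlast
  have hat := h₁ (n - 1) (by omega) t ht
  rw [Nat.cast_sub (by omega)] at hat
  push_cast at hat
  have hnR : (R₃ : ℝ) ≤ n := by exact_mod_cast (by omega : R₃ ≤ n)
  have hK0 : (0 : ℝ) ≤ K := by positivity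
  -- The gap a - α pays for passing from n - 1 to n and for K. Since t > K, the start p cannot lie
  -- below R₂, where the upper rate is not yet valid.
  have hαt : α * n + K < t := by nlinarith
  refine ⟨p, t, hpt, hp1, by linarith, ?_, hz, hstart⟩
  refine h₂ p ?_ t htp
  by_contra! hlt
  have h4 := maxRun_mono ω hlt.le
  rw [htp, hK] at h4
  have h5 : (t : ℝ) ≤ K := by exact_mod_cast h4
  have : 0 ≤ α * n := by positivity
  linarith

/-- From αn ≤ t ≤ Bp the run starts at p ≥ (α/B)n. For large n this p is itself past the previous
threshold and is preceded by a nonzero letter, so the argument iterates. -/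
theorem exists_threshold_nestedRuns {ω : SymbolicSpace m} (hω : NotEventuallyZero ω) {α a B : ℝ}
    (hα : 0 < α) (hαa : α < a) (hB : 0 < B)
    (hlow : ENNReal.ofReal a < lowerL ω) (hup : upperL ω < ENNReal.ofReal B) (J : ℕ) :
    ∃ R : ℕ, ∀ n ≥ R, ω.letter (n - 1) ≠ 0 → NestedRuns α (α / B) J ω n := by
  obtain ⟨R, hR2, hR⟩ := exists_threshold_run hω hα.le hαa hlow hup
  induction J with
  | zero => exact ⟨0, fun n _ _ => trivial⟩
  | succ J ih =>
    obtain ⟨R', hR'⟩ := ih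
    obtain ⟨R₃, h₃⟩ := exists_nat_gt (((R' : ℝ) + 2) / (α / B))
    have hρ : 0 < α / B := by positivity
    rw [div_lt_iff₀ hρ] at h₃
    refine ⟨R + R₃, fun n hn hlast => ?_⟩
    obtain ⟨p, t, hpt, hp1, hαt, htB, hz, hstart⟩ := hR n (by omega) hlast
    have hp : α / B * n ≤ p := by
      rw [div_mul_eq_mul_div, div_le_iff₀ hB]
      linarith
    have hnR : (R₃ : ℝ) ≤ n := by exact_mod_cast (by omega : R₃ ≤ n)
    have hpR : R' + 2 < p := by
      have : (R' : ℝ) + 2 < p := by nlinarith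
      exact_mod_cast this
    exact ⟨p, t, hpt, hαt, hp, hz, hR' p (by omega) (hstart.resolve_left (by omega))⟩

/-- The lower and upper growth rates of the longest run satisfy `a ≤ b (1 - a)`. -/
theorem not_upperL_lt {ω : SymbolicSpace m} {a B : ℝ} (ha : 0 < a) (ha1 : a < 1)
    (hB : B < a / (1 - a)) (hlow : ENNReal.ofReal a < lowerL ω) :
    ¬ upperL ω < ENNReal.ofReal B := by
  intro hup
  have hB0 : 0 < B := ENNReal.ofReal_pos.1 (bot_le.trans_lt hup)
  -- For an eventually zero word L_N is eventually infinite, against the finite upper rate.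
  have hω : NotEventuallyZero ω := by
    by_contra hcon
    simp only [NotEventuallyZero, not_forall, not_exists, not_and, not_not] at hcon
    obtain ⟨n, hn⟩ := hcon
    have hev : ∀ᶠ N : ℕ in atTop, ENNReal.ofReal B ≤
        ((maxRun ω N : ℕ∞) : ℝ≥0∞) / (N : ℝ≥0∞) := by
      filter_upwards [eventually_ge_atTop (n + 1)] with N hN
      have : maxRun ω N = ⊤ := by
        refine top_le_iff.1 (le_trans (ENat.forall_natCast_le_iff_le.1 fun k _ => ?_)
          (zeroRun_le_maxRun (n := N) (by omega) le_rfl))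
        rw [le_zeroRun_iff]
        exact fun i _ => hn _ (by omega)
      rw [this]
      simp [ENNReal.top_div]
    have := le_liminf_of_le (by isBoundedDefault) hev
    exact absurd (this.trans (liminf_le_limsup (by isBoundedDefault) (by isBoundedDefault)))
      (not_le.2 hup)
  have h1a : 0 < 1 - a := by linarith
  -- With α > B/(1 + B), a run with t ≥ αn and t ≤ Bp would give Bn ≥ B(p + t) ≥ (1 + B)t > Bn.
  obtain ⟨α, hαB, hαa⟩ : ∃ α, B / (1 + B) < α ∧ α < a := by
    refine exists_between ?_
    rw [lt_div_iff₀ h1a] at hB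
    rw [div_lt_iff₀ (by linarith)]
    linarith
  have hα : 0 < α := lt_trans (by positivity) hαB
  rw [div_lt_iff₀ (by linarith)] at hαB
  obtain ⟨R, hR2, hR⟩ := exists_threshold_run hω hα.le hαa hlow hup
  obtain ⟨i, hi, hne⟩ := hω R
  obtain ⟨p, t, hpt, hp1, hαt, htB, -⟩ := hR (i + 1) (by omega) hne
  have hp0 : (1 : ℝ) ≤ p := by exact_mod_cast hp1
  have hpt' : (p : ℝ) + t ≤ ((i + 1 : ℕ) : ℝ) := by exact_mod_cast hpt
  nlinarith

end Dynamics

/-! ### Upper bounds for the dimension. -/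

section UpperBound

variable {m : ℕ} [NeZero m]

omit [NeZero m] in
theorem topEntropy_nonneg {S : Set (SymbolicSpace m)} (hS : IsSubshift S) (hne : S.Nonempty) :
    0 ≤ topEntropy S := by
  refine ge_of_tendsto' (tendsto_topEntropy hS hne) fun n => ?_
  exact div_nonneg (Real.log_natCast_nonneg _) (Nat.cast_nonneg n)

theorem le_ofReal_of_forall_nnreal {A : ℝ≥0∞} {x : ℝ} (h : ∀ d : ℝ≥0, x < d → A ≤ d) :
    A ≤ ENNReal.ofReal x := by
  by_contra! hlt
  obtain ⟨d, h1, h2⟩ := ENNReal.lt_iff_exists_nnreal_btwn.1 hlt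
  refine absurd (h d ?_) (not_le.2 h2)
  by_contra! hle
  have := ENNReal.ofReal_le_ofReal hle
  rw [ENNReal.ofReal_coe_nnreal] at this
  exact absurd this (not_le.2 h1)

theorem dimH_subshift_le (hm : 2 ≤ m) {S : Set (SymbolicSpace m)} (hS : IsSubshift S)
    (hne : S.Nonempty) : dimH S ≤ ENNReal.ofReal (topEntropy S / Real.log m) := by
  have hlog : 0 < Real.log m := Real.log_pos (by exact_mod_cast hm)
  refine le_ofReal_of_forall_nnreal fun d hd => ?_
  rw [div_lt_iff₀ hlog] at hd
  obtain ⟨η, h1, h2⟩ := exists_between hd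
  refine (dimH_mono fun ω hω => ?_).trans (dimH_nestedRuns_le hm hS hne (α := 0) (ρ := 0) (b := 0)
    le_rfl le_rfl h1 ((topEntropy_nonneg hS hne).trans h1.le) 0 (d := d) ?_)
  · refine ⟨hω, Eventually.frequently (Eventually.of_forall fun n => ⟨trivial, fun i hi => ?_⟩)⟩
    simp at hi
  · simpa [runDensity] using h2

/-- The discarded words form a countable set, of dimension 0; on the others every L_N is finite. -/
theorem dimH_le_of_notEventuallyZero {E : Set (SymbolicSpace m)} {A : ℝ≥0∞}
    (h : dimH (E ∩ {ω | NotEventuallyZero ω}) ≤ A) : dimH E ≤ A := by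
  have hsub : E ⊆ (E ∩ {ω | NotEventuallyZero ω}) ∪ {ω | ¬ NotEventuallyZero ω} := fun ω hω => by
    by_cases hc : NotEventuallyZero ω
    · exact Or.inl ⟨hω, hc⟩
    · exact Or.inr hc
  refine (dimH_mono hsub).trans ?_
  rw [dimH_union, dimH_countable countable_eventuallyZero]
  exact max_le h zero_le

/-- Only the long run after the prefix is used here: no nested runs, so J = 0. -/
theorem dimH_le_upperL_le (hm : 2 ≤ m) {S : Set (SymbolicSpace m)} (hS : IsSubshift S)
    (hne : S.Nonempty) {b : ℝ} (hb : 0 < b) :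
    dimH {ω | ω ∈ S ∧ ENNReal.ofReal b ≤ upperL ω} ≤
      ENNReal.ofReal (1 / (1 + b) * (topEntropy S / Real.log m)) := by
  have hlog : 0 < Real.log m := Real.log_pos (by exact_mod_cast hm)
  refine dimH_le_of_notEventuallyZero (le_ofReal_of_forall_nnreal fun d hd => ?_)
  have hd' : topEntropy S < d * ((1 + b) * Real.log m) := by
    rw [← mul_div_assoc, div_lt_iff₀ hlog, one_div_mul_eq_div, div_lt_iff₀ (by linarith)] at hd
    linarith
  have hev : ∀ᶠ ε : ℝ in 𝓝[>] 0, topEntropy S < d * ((1 + (b - ε)) * Real.log m) := by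
    have hc : Continuous fun ε : ℝ => d * ((1 + (b - ε)) * Real.log m) := by fun_prop
    have := (hc.tendsto 0).mono_left (nhdsWithin_le_nhds (s := Set.Ioi 0))
    exact this.eventually_const_lt (by simpa using hd')
  obtain ⟨ε, hε, hεpos, hεb⟩ := (hev.and (Ioo_mem_nhdsGT hb)).exists
  obtain ⟨η, h1, h2⟩ := exists_between hε
  refine (dimH_mono ?_).trans (dimH_nestedRuns_le hm hS hne (α := 0) (ρ := 0) (b := b - ε)
    le_rfl le_rfl h1 ((topEntropy_nonneg hS hne).trans h1.le) 0 (d := d) ?_)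
  · rintro ω ⟨⟨hω, hup⟩, hnz⟩
    refine ⟨hω, (frequently_long_run hnz (b := b - ε) (by linarith) (lt_of_lt_of_le ?_ hup)).mono
      fun n hn => ⟨trivial, hn.2⟩⟩
    exact (ENNReal.ofReal_lt_ofReal_iff hb).2 (by linarith)
  · simpa [runDensity] using h2

theorem dimH_upperL_eq_top (hm : 2 ≤ m) {S : Set (SymbolicSpace m)} (hS : IsSubshift S)
    (hne : S.Nonempty) : dimH {ω | ω ∈ S ∧ upperL ω = ∞} = 0 := by
  refine le_antisymm ?_ zero_le
  have hlim : Tendsto (fun b : ℝ => ENNReal.ofReal (1 / (1 + b) * (topEntropy S / Real.log m)))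
      atTop (𝓝 0) := by
    rw [← ENNReal.ofReal_zero, ← zero_mul (topEntropy S / Real.log m)]
    refine ENNReal.tendsto_ofReal (Tendsto.mul_const _ ?_)
    simp only [one_div]
    exact tendsto_inv_atTop_zero.comp (tendsto_atTop_add_const_left _ _ tendsto_id)
  refine ge_of_tendsto hlim ?_
  filter_upwards [eventually_gt_atTop 0] with b hb
  refine (dimH_mono ?_).trans (dimH_le_upperL_le hm hS hne hb)
  rintro ω ⟨hω, h⟩
  exact ⟨hω, h ▸ le_top⟩

theorem tendsto_runDensity {α ρ : ℝ} (hρ : 0 ≤ ρ) (hρ1 : ρ < 1) :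
    Tendsto (runDensity α ρ) atTop (𝓝 (α / (1 - ρ))) := by
  have := (hasSum_geometric_of_lt_one hρ hρ1).tendsto_sum_nat.const_mul α
  rw [div_eq_mul_inv]
  exact this

/-- Take J nested runs with ratio near a/B and let J grow: the geometric series tends to a/(1 -
a/B). -/
theorem dimH_lowerL_upperL_le (hm : 2 ≤ m) {S : Set (SymbolicSpace m)} (hS : IsSubshift S)
    (hne : S.Nonempty) {a b B : ℝ} (ha : 0 < a) (hb : 0 < b) (haB : a < B) :
    dimH {ω | ω ∈ S ∧ ENNReal.ofReal a ≤ lowerL ω ∧ ENNReal.ofReal b ≤ upperL ω ∧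
        upperL ω ≤ ENNReal.ofReal B} ≤
      ENNReal.ofReal ((1 - a / (1 - a / B)) / (1 + b) * (topEntropy S / Real.log m)) := by
  have hlog : 0 < Real.log m := Real.log_pos (by exact_mod_cast hm)
  have hB : 0 < B := ha.trans haB
  refine dimH_le_of_notEventuallyZero (le_ofReal_of_forall_nnreal fun d hd => ?_)
  have hd' : topEntropy S * (1 - a / (1 - a / B)) < d * ((1 + b) * Real.log m) := by
    rw [← mul_div_assoc, div_lt_iff₀ hlog, div_mul_eq_mul_div, div_lt_iff₀ (by linarith)] at hd
    linarith
  have hρ0 : a / B < 1 := (div_lt_one hB).2 haB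
  -- A single ε perturbs the entropy, the rates a, b, B and the truncated geometric series;
  -- continuity at 0 preserves the strict inequality.
  have hev : ∀ᶠ ε : ℝ in 𝓝[>] 0,
      (topEntropy S + ε) * (1 - ((a - ε) / (1 - (a - ε) / (B + ε)) - ε)) <
        d * ((1 + (b - ε)) * Real.log m) := by
    have hc1 : ContinuousAt (fun ε : ℝ => d * ((1 + (b - ε)) * Real.log m)) 0 := by fun_prop
    have hc2 : ContinuousAt (fun ε : ℝ =>
        (topEntropy S + ε) * (1 - ((a - ε) / (1 - (a - ε) / (B + ε)) - ε))) 0 := by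
      have h1 : B + 0 ≠ 0 := by linarith
      have h2 : 1 - (a - 0) / (B + 0) ≠ 0 := by simp only [sub_zero, add_zero]; linarith
      fun_prop (disch := assumption)
    have := (hc2.eventually_lt hc1 (by simpa using hd'))
    exact this.filter_mono nhdsWithin_le_nhds
  obtain ⟨ε, ⟨hε, hεpos, hεb⟩, hε0, hεa⟩ :=
    ((hev.and (Ioo_mem_nhdsGT hb)).and (Ioo_mem_nhdsGT ha)).exists
  set ρ := (a - ε) / (B + ε) with hρ
  have hρpos : 0 ≤ ρ := div_nonneg (by linarith) (by linarith)
  have hρ1 : ρ < 1 := (div_lt_one (by linarith)).2 (by linarith)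
  obtain ⟨J, hJ⟩ := ((tendsto_runDensity (α := a - ε) hρpos hρ1).eventually_const_lt
    (show (a - ε) / (1 - ρ) - ε < (a - ε) / (1 - ρ) by linarith)).exists
  have hη0 : 0 < topEntropy S + ε := by linarith [topEntropy_nonneg hS hne]
  refine (dimH_mono ?_).trans (dimH_nestedRuns_le hm hS hne (α := a - ε) (ρ := ρ) (b := b - ε)
    (η := topEntropy S + ε) (by linarith) hρpos (by linarith) hη0.le J (d := d) ?_)
  · rintro ω ⟨⟨hω, hlow, hup, hup'⟩, hnz⟩
    obtain ⟨R, hR⟩ := exists_threshold_nestedRuns hnz (α := a - ε) (a := a - ε / 2) (B := B + ε)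
      (by linarith) (by linarith) (by linarith)
      (lt_of_lt_of_le ((ENNReal.ofReal_lt_ofReal_iff ha).2 (by linarith)) hlow)
      (lt_of_le_of_lt hup' ((ENNReal.ofReal_lt_ofReal_iff (by linarith)).2 (by linarith))) J
    refine ⟨hω, ((frequently_long_run hnz (b := b - ε) (by linarith)
      (lt_of_lt_of_le ?_ hup)).and_eventually (eventually_ge_atTop R)).mono
      fun n hn => ⟨hR n hn.2 hn.1.1, hn.1.2⟩⟩
    exact (ENNReal.ofReal_lt_ofReal_iff hb).2 (by linarith)
  · refine lt_of_le_of_lt ?_ hε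
    gcongr

end UpperBound

/-! ### Infinite concatenations from specification. -/

section Gluing

variable {m : ℕ} [NeZero m]

omit [NeZero m] in
theorem length_of_mem_words {S : Set (SymbolicSpace m)} {n : ℕ} {w : List (Fin m)}
    (h : w ∈ words S n) : w.length = n := by
  obtain ⟨u, -, rfl⟩ := h
  exact pre_length u n

omit [NeZero m] in
theorem mem_language_iff {S : Set (SymbolicSpace m)} {w : List (Fin m)} :
    w ∈ language S ↔ 1 ≤ w.length ∧ w ∈ words S w.length := by
  constructor
  · rintro ⟨n, hn, hw⟩
    rw [length_of_mem_words hw]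
    exact ⟨hn, hw⟩
  · rintro ⟨h1, h2⟩
    exact ⟨_, h1, h2⟩

omit [NeZero m] in
/-- Specification glues an infinite sequence of words of the language, with gaps of length `M`. -/
theorem exists_glue (hm : 2 ≤ m) {S : Set (SymbolicSpace m)} (hS : IsSubshift S) {M : ℕ}
    (hspec : ∀ u ∈ language S, ∀ v ∈ language S, ∃ w ∈ words S M, u ++ w ++ v ∈ language S)
    (V : ℕ → List (Fin m)) (hV : ∀ j, V j ∈ language S) :
    ∃ ω ∈ S, ∀ j i : ℕ, i < (V j).length →
      (V j)[i]? = some (ω.letter (∑ k ∈ Finset.range j, ((V k).length + M) + i)) := by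
  choose! c hc1 hc2 using hspec
  let W : ℕ → List (Fin m) := fun j =>
    Nat.rec (V 0) (fun j w => w ++ c w (V (j + 1)) ++ V (j + 1)) j
  have hWs : ∀ j, W (j + 1) = W j ++ c (W j) (V (j + 1)) ++ V (j + 1) := fun j => rfl
  have hW : ∀ j, W j ∈ language S := by
    intro j
    induction j with
    | zero => exact hV 0
    | succ j ih => rw [hWs]; exact hc2 _ ih _ (hV _)
  have hlen : ∀ j, (W j).length =
      ∑ k ∈ Finset.range j, ((V k).length + M) + (V j).length := by
    intro j
    induction j with
    | zero => simp [W]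
    | succ j ih =>
      rw [hWs, List.length_append, List.length_append, ih,
        length_of_mem_words (hc1 _ (hW j) _ (hV (j + 1))), Finset.sum_range_succ]
      omega
  have hpre : ∀ j k, j ≤ k → W j <+: W k := by
    intro j k hjk
    induction k, hjk using Nat.le_induction with
    | base => exact List.prefix_rfl
    | succ k _ ih =>
      refine ih.trans ?_
      rw [hWs, List.append_assoc]
      exact List.prefix_append _ _
  have hlt : ∀ j, j < (W j).length := by
    intro j
    induction j with
    | zero => exact (mem_language_iff.1 (hV 0)).1
    | succ j ih =>
      have := (mem_language_iff.1 (hV (j + 1))).1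
      rw [hWs, List.length_append, List.length_append]
      omega
  -- The words W j extend one another and have length greater than j, so their diagonal is the limit
  -- word.
  let ω : SymbolicSpace m := ⟨fun i => (W i)[i]'(hlt i)⟩
  have hω : ∀ j i, i < (W j).length → (W j)[i]? = some (ω.letter i) := by
    intro j i hi
    rw [← List.getElem?_eq_getElem (hlt i)]
    rcases le_total i j with h | h
    · obtain ⟨t, ht⟩ := hpre i j h
      rw [← ht, List.getElem?_append_left (hlt i)]
    · obtain ⟨t, ht⟩ := hpre j i h
      rw [← ht, List.getElem?_append_left hi]
  refine ⟨ω, ?_, ?_⟩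
  · have hm1 : (1 : ℝ) < m := by exact_mod_cast hm
    -- Each W j is a prefix of a point of S, so the limit is approximated from S and closedness
    -- applies.
    rw [← hS.1.closure_eq, Metric.mem_closure_iff]
    intro ε hε
    obtain ⟨j, hj⟩ := exists_pow_lt_of_lt_one hε (inv_lt_one_of_one_lt₀ hm1)
    obtain ⟨-, u, hu, huW⟩ := mem_language_iff.1 (hW j)
    refine ⟨u, hu, (dist_le_of_agree (n := j) fun i hi => ?_).trans_lt hj⟩
    have hi' := hi.trans (hlt j)
    have h1 := hω j i hi'
    rw [← huW, List.getElem?_eq_getElem (by rwa [pre_length]), pre_getElem] at h1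
    exact (Option.some.inj h1).symm
  · intro j i hi
    rw [← hω j _ (by rw [hlen]; omega)]
    cases j with
    | zero => simp [W]
    | succ j =>
      have h1 : (W j ++ c (W j) (V (j + 1))).length =
          ∑ k ∈ Finset.range (j + 1), ((V k).length + M) := by
        rw [List.length_append, hlen, length_of_mem_words (hc1 _ (hW j) _ (hV (j + 1))),
          Finset.sum_range_succ]
        omega
      rw [hWs, ← h1, List.getElem?_append_right (by omega), Nat.add_sub_cancel_left]

/-- The starting cells of consecutive blocks, if the block starting at cell `i` takes `τ i`
cells. -/
def blockStart (τ : ℕ → ℕ) : ℕ → ℕ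
  | 0 => 0
  | j + 1 => blockStart τ j + τ (blockStart τ j)

theorem exists_blockStart_le {τ : ℕ → ℕ} (hτ : ∀ i, 1 ≤ τ i) (i : ℕ) :
    ∃ j, blockStart τ j ≤ i ∧ i < blockStart τ j + τ (blockStart τ j) := by
  induction i with
  | zero => exact ⟨0, le_rfl, by have := hτ (blockStart τ 0); omega⟩
  | succ i ih =>
    obtain ⟨j, h1, h2⟩ := ih
    by_cases h : i + 1 < blockStart τ j + τ (blockStart τ j)
    · exact ⟨j, by omega, h⟩
    · have h3 : blockStart τ (j + 1) = i + 1 := by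
        simp only [blockStart]
        omega
      exact ⟨j + 1, h3.le, by have := hτ (blockStart τ (j + 1)); omega⟩

omit [NeZero m] in
-- Each word with its gap fills exactly τ i cells, so block positions depend on τ alone and not on
-- the letters chosen.
theorem exists_glue_cells (hm : 2 ≤ m) {S : Set (SymbolicSpace m)} (hS : IsSubshift S) {M q : ℕ}
    (hspec : ∀ u ∈ language S, ∀ v ∈ language S, ∃ w ∈ words S M, u ++ w ++ v ∈ language S)
    (τ : ℕ → ℕ) (V : ℕ → List (Fin m)) (hV : ∀ i, V i ∈ language S)
    (hlen : ∀ i, (V i).length + M = q * τ i) :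
    ∃ ω ∈ S, ∀ j, pre (shift^[q * blockStart τ j] ω) (V (blockStart τ j)).length =
      V (blockStart τ j) := by
  obtain ⟨ω, hω, h⟩ := exists_glue hm hS hspec (fun j => V (blockStart τ j)) (fun j => hV _)
  refine ⟨ω, hω, fun j => ?_⟩
  have hpos : ∀ j, ∑ k ∈ Finset.range j, ((V (blockStart τ k)).length + M) =
      q * blockStart τ j := by
    intro j
    induction j with
    | zero => simp [blockStart]
    | succ j ih => rw [Finset.sum_range_succ, ih, hlen, blockStart, mul_add]
  refine List.ext_getElem (pre_length _ _) fun i h1 h2 => ?_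
  have := h j i h2
  rw [List.getElem?_eq_getElem h2, hpos] at this
  rw [pre_getElem, shift_iterate_apply]
  exact (Option.some.inj this).symm

end Gluing

/-! ### Placement of long zero blocks and free cells. -/

section Schedule

/-- A schedule of long zero blocks: the `k`-th one takes the `T k` cells starting at `N k`. -/
structure Schedule where
  N : ℕ → ℕ
  T : ℕ → ℕ
  one_le_N : ∀ k, 1 ≤ N k
  one_le_T : ∀ k, 1 ≤ T k
  mono_T : Monotone T
  add_lt : ∀ k, N k + T k < N (k + 1)

namespace Schedule

variable (σ : Schedule)

theorem strictMono_N : StrictMono σ.N := strictMono_nat_of_lt_succ fun k => by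
  have := σ.add_lt k
  omega

theorem add_lt_of_lt {j k : ℕ} (h : j < k) : σ.N j + σ.T j < σ.N k :=
  (σ.add_lt j).trans_le (σ.strictMono_N.monotone h)

/-- The cells outside the long zero blocks. -/
def Free (i : ℕ) : Prop := ∀ k, ¬ (σ.N k ≤ i ∧ i < σ.N k + σ.T k)

/-- Blocks are separated by at least one cell because `add_lt` is strict; this is what stops a zero
run after a block. -/
theorem free_end (j : ℕ) : σ.Free (σ.N j + σ.T j) := by
  rintro k ⟨h1, h2⟩
  rcases lt_trichotomy k j with h | rfl | h
  · have := σ.add_lt_of_lt h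
    omega
  · omega
  · have := σ.add_lt_of_lt h
    omega

theorem infinite_free : {i | σ.Free i}.Infinite := by
  refine Set.infinite_of_forall_exists_gt fun n => ⟨_, σ.free_end n, ?_⟩
  have := σ.strictMono_N.le_apply (x := n)
  have := σ.one_le_T n
  omega

open Classical in
/-- The number of cells occupied by the block starting at cell `i`. -/
noncomputable def duration (i : ℕ) : ℕ := if h : ∃ k, σ.N k = i then σ.T h.choose else 1

theorem duration_N (k : ℕ) : σ.duration (σ.N k) = σ.T k := by
  have h : ∃ j, σ.N j = σ.N k := ⟨k, rfl⟩
  rw [duration, dif_pos h, σ.strictMono_N.injective h.choose_spec]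

theorem duration_of_ne {i : ℕ} (h : ∀ k, σ.N k ≠ i) : σ.duration i = 1 :=
  dif_neg fun ⟨k, hk⟩ => h k hk

theorem one_le_duration (i : ℕ) : 1 ≤ σ.duration i := by
  by_cases h : ∃ k, σ.N k = i
  · obtain ⟨k, rfl⟩ := h
    rw [duration_N]
    exact σ.one_le_T k
  · rw [duration_of_ne]
    exact fun k hk => h ⟨k, hk⟩

theorem Free.ne_N {σ : Schedule} {i : ℕ} (h : σ.Free i) (k : ℕ) : σ.N k ≠ i := fun hk =>
  h k ⟨hk.le, by have := σ.one_le_T k; omega⟩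

theorem exists_blockStart_of_free {i : ℕ} (h : σ.Free i) : ∃ j, blockStart σ.duration j = i := by
  obtain ⟨j, h1, h2⟩ := exists_blockStart_le σ.one_le_duration i
  refine ⟨j, ?_⟩
  by_cases hk : ∃ k, σ.N k = blockStart σ.duration j
  · obtain ⟨k, hk⟩ := hk
    rw [← hk, duration_N] at h2
    exact absurd ⟨hk.le.trans h1, h2⟩ (h k)
  · rw [σ.duration_of_ne fun k hk' => hk ⟨k, hk'⟩] at h2
    omega

theorem exists_blockStart_N (k : ℕ) : ∃ j, blockStart σ.duration j = σ.N k := by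
  obtain ⟨j, h1, h2⟩ := exists_blockStart_le σ.one_le_duration (σ.N k)
  refine ⟨j, ?_⟩
  by_cases hl : ∃ l, σ.N l = blockStart σ.duration j
  · obtain ⟨l, hl⟩ := hl
    rw [← hl, duration_N] at h2
    rw [← hl] at h1 ⊢
    rcases lt_trichotomy l k with h | rfl | h
    · have := σ.add_lt_of_lt h
      omega
    · rfl
    · have := σ.strictMono_N h
      omega
  · rw [σ.duration_of_ne fun k hk' => hl ⟨k, hk'⟩] at h2
    omega

open Classical in
/-- The number of free cells before cell `i`. -/
noncomputable def freeCount (i : ℕ) : ℕ := Nat.count σ.Free i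

theorem exists_free_of_lt_freeCount {i j : ℕ} (h : j < σ.freeCount i) :
    ∃ k < i, σ.Free k ∧ σ.freeCount k = j := by
  classical
  exact ⟨Nat.nth σ.Free j, Nat.nth_lt_of_lt_count h,
    Nat.nth_mem_of_infinite σ.infinite_free j, Nat.count_nth_of_infinite σ.infinite_free j⟩

/-- Occupied cells before i lie in the first k blocks or in the part of block k to the left of i. -/
theorem le_freeCount_add {k i : ℕ} (hi : i < σ.N (k + 1)) :
    i ≤ σ.freeCount i + (∑ j ∈ Finset.range k, σ.T j + min (σ.T k) (i - σ.N k)) := by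
  classical
  have hsub : (Finset.range i).filter (fun n => ¬ σ.Free n) ⊆
      ((Finset.range k).biUnion fun j => Finset.Ico (σ.N j) (σ.N j + σ.T j)) ∪
        Finset.Ico (σ.N k) (min (σ.N k + σ.T k) i) := by
    intro n hn
    rw [Finset.mem_filter, Finset.mem_range] at hn
    obtain ⟨hni, hf⟩ := hn
    simp only [Free, not_forall, not_not] at hf
    obtain ⟨j, hj1, hj2⟩ := hf
    rw [Finset.mem_union, Finset.mem_biUnion, Finset.mem_Ico]
    have hjk : j < k + 1 := by
      rw [← σ.strictMono_N.lt_iff_lt]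
      omega
    rcases Nat.lt_succ_iff_lt_or_eq.1 hjk with h | rfl
    · exact Or.inl ⟨j, Finset.mem_range.2 h, Finset.mem_Ico.2 ⟨hj1, hj2⟩⟩
    · exact Or.inr ⟨hj1, lt_min hj2 hni⟩
  have h1 := (Finset.card_le_card hsub).trans (Finset.card_union_le _ _)
  have h2 : ((Finset.range k).biUnion fun j => Finset.Ico (σ.N j) (σ.N j + σ.T j)).card ≤
      ∑ j ∈ Finset.range k, σ.T j := by
    refine Finset.card_biUnion_le.trans (Finset.sum_le_sum fun j _ => ?_)
    rw [Nat.card_Ico]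
    omega
  have h3 := Finset.card_filter_add_card_filter_not (s := Finset.range i) σ.Free
  rw [Finset.card_range] at h3
  rw [Nat.card_Ico] at h1
  have h4 : σ.freeCount i = ((Finset.range i).filter σ.Free).card := by
    rw [freeCount, Nat.count_eq_card_filter_range]
  have h5 : min (σ.N k + σ.T k) i - σ.N k = min (σ.T k) (i - σ.N k) := by omega
  rw [h5] at h1
  have h6 : ((Finset.range i).filter fun n => ¬ σ.Free n).card + σ.freeCount i = i := by
    rw [h4, add_comm]
    convert h3
  omega

end Schedule

end Schedule

/-! ### Words built from a schedule and a digit sequence. -/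

section Coded

variable {m : ℕ} [NeZero m]

/-- `ω` follows the schedule `σ` on cells of length `q = ℓ + M`, with long blocks of zeros as
prescribed and with the word `e (x j)` in the `j`-th free cell. -/
structure IsCoded (σ : Schedule) (ℓ M : ℕ) {K : ℕ} (e : Fin K → List (Fin m)) (x : ℕ → Fin K)
    (ω : SymbolicSpace m) : Prop where
  free : ∀ i, σ.Free i → pre (shift^[(ℓ + M) * i] ω) ℓ = e (x (σ.freeCount i))
  zero : ∀ k, ∀ r < (ℓ + M) * σ.T k - M, ω.letter ((ℓ + M) * σ.N k + r) = 0

theorem pre_zeroWord (n : ℕ) : pre (zeroWord m) n = List.replicate n 0 := by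
  simp [pre, zeroWord, List.ofFn_const]

theorem exists_isCoded (hm : 2 ≤ m) {S : Set (SymbolicSpace m)} (hS : IsSubshift S) {M ℓ : ℕ}
    (hspec : ∀ u ∈ language S, ∀ v ∈ language S, ∃ w ∈ words S M, u ++ w ++ v ∈ language S)
    (hzero : zeroWord m ∈ S) (σ : Schedule) (hℓ : 1 ≤ ℓ) {K : ℕ} (e : Fin K → List (Fin m))
    (he : ∀ d, e d ∈ words S ℓ) (x : ℕ → Fin K) : ∃ ω ∈ S, IsCoded σ ℓ M e x ω := by
  classical
  -- Values at cells interior to a zero block are irrelevant: gluing reads V only at block starts.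
  -- The M letters removed from a zero block leave room for the gap.
  let V : ℕ → List (Fin m) := fun i => if ∃ k, σ.N k = i
    then List.replicate ((ℓ + M) * σ.duration i - M) 0 else e (x (σ.freeCount i))
  have hdur : ∀ i, ℓ + M ≤ (ℓ + M) * σ.duration i := fun i =>
    Nat.le_mul_of_pos_right _ (σ.one_le_duration i)
  have hV : ∀ i, V i ∈ language S := by
    intro i
    simp only [V]
    split_ifs with h
    · refine ⟨_, ?_, zeroWord m, hzero, pre_zeroWord _⟩
      have := hdur i
      omega
    · exact ⟨ℓ, hℓ, he _⟩
  have hlen : ∀ i, (V i).length + M = (ℓ + M) * σ.duration i := by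
    intro i
    simp only [V]
    split_ifs with h
    · have := hdur i
      rw [List.length_replicate]
      omega
    · rw [length_of_mem_words (he _), σ.duration_of_ne fun k hk => h ⟨k, hk⟩, mul_one]
  obtain ⟨ω, hω, h⟩ := exists_glue_cells hm hS hspec σ.duration V hV hlen
  refine ⟨ω, hω, ⟨fun i hi => ?_, fun k r hr => ?_⟩⟩
  · obtain ⟨j, hj⟩ := σ.exists_blockStart_of_free hi
    have := h j
    have hVi : V i = e (x (σ.freeCount i)) := if_neg fun ⟨k, hk⟩ => hi.ne_N k hk
    rwa [hj, hVi, length_of_mem_words (he _)] at this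
  · obtain ⟨j, hj⟩ := σ.exists_blockStart_N k
    have := h j
    have hVi : V (σ.N k) = List.replicate ((ℓ + M) * σ.T k - M) 0 := by
      simp only [V]
      rw [if_pos ⟨k, rfl⟩, σ.duration_N]
    rw [hj, hVi, List.length_replicate, ← pre_zeroWord, pre_eq_iff] at this
    have := this r hr
    rwa [shift_iterate_apply] at this

variable {σ : Schedule} {ℓ M K : ℕ} {e : Fin K → List (Fin m)} {x : ℕ → Fin K}
  {ω : SymbolicSpace m}

theorem IsCoded.exists_ne_zero (h : IsCoded σ ℓ M e x ω) (he : ∀ d, e d ≠ List.replicate ℓ 0)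
    {i : ℕ} (hi : σ.Free i) : ∃ r < ℓ, ω.letter ((ℓ + M) * i + r) ≠ 0 := by
  by_contra! hcon
  exact he _ ((h.free i hi).symm.trans (pre_eq_replicate hcon))

theorem IsCoded.notEventuallyZero (h : IsCoded σ ℓ M e x ω) (he : ∀ d, e d ≠ List.replicate ℓ 0)
    (hℓ : 1 ≤ ℓ) : NotEventuallyZero ω := by
  intro n
  obtain ⟨i, hi, hni⟩ := σ.infinite_free.exists_gt n
  obtain ⟨r, -, hr⟩ := h.exists_ne_zero he hi
  refine ⟨_, ?_, hr⟩
  nlinarith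

theorem IsCoded.le_maxRun (h : IsCoded σ ℓ M e x ω) (hℓ : 1 ≤ ℓ) {k n : ℕ}
    (hn : (ℓ + M) * σ.N k ≤ n) : (((ℓ + M) * σ.T k - M : ℕ) : ℕ∞) ≤ maxRun ω n := by
  have h1 : 1 ≤ (ℓ + M) * σ.N k := Nat.mul_pos (by omega) (σ.one_le_N k)
  exact (le_zeroRun_iff.2 (h.zero k)).trans (zeroRun_le_maxRun h1 hn)

/-- From a start in cell i, some free cell among i + 1, …, i + 1 + T_k contains a nonzero letter, so
the run is shorter than T_k + 2 cells. Starts in the cell just before block k + 1 are excluded,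
since their runs may continue into that block. -/
theorem IsCoded.maxRun_le (h : IsCoded σ ℓ M e x ω) (he : ∀ d, e d ≠ List.replicate ℓ 0)
    (hℓ : 1 ≤ ℓ) {k n : ℕ} (hn : n < (ℓ + M) * (σ.N (k + 1) - 1)) :
    maxRun ω n ≤ (((ℓ + M) * (σ.T k + 2) : ℕ) : ℕ∞) := by
  rw [maxRun_le_iff]
  intro p _ hpn
  set q := ℓ + M with hq
  have hq0 : 0 < q := by omega
  set i := p / q with hi
  have hip : q * i ≤ p := Nat.mul_div_le p q
  have hpi : p < q * (i + 1) := Nat.lt_mul_div_succ p hq0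
  have hiN' : i < σ.N (k + 1) - 1 := Nat.div_lt_of_lt_mul (hpn.trans_lt hn)
  clear_value i
  clear hi
  have hiN : i + 1 < σ.N (k + 1) := by omega
  obtain ⟨f, hf, hf1, hf2⟩ : ∃ f, σ.Free f ∧ i + 1 ≤ f ∧ f ≤ i + 1 + σ.T k := by
    by_cases hfree : σ.Free (i + 1)
    · exact ⟨i + 1, hfree, le_rfl, by omega⟩
    · simp only [Schedule.Free, not_forall, not_not] at hfree
      obtain ⟨j, hj1, hj2⟩ := hfree
      have hjk : j < k + 1 := by
        rw [← σ.strictMono_N.lt_iff_lt]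
        omega
      have := σ.mono_T (Nat.lt_succ_iff.1 hjk)
      exact ⟨_, σ.free_end j, by omega, by omega⟩
  obtain ⟨r, hr, hne⟩ := h.exists_ne_zero he hf
  rw [← hq] at hne
  by_contra! hlt
  have h1 : q * (i + 1) ≤ q * f := Nat.mul_le_mul_left q hf1
  have h2 : q * f ≤ q * (i + 1 + σ.T k) := Nat.mul_le_mul_left q hf2
  have h3 : q * f + r < p + q * (σ.T k + 2) := by
    simp only [mul_add] at h1 h2 ⊢
    omega
  have := le_zeroRun_iff.1 hlt.le (q * f + r - p) (by omega)
  rw [show p + (q * f + r - p) = q * f + r by omega] at this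
  exact hne this

end Coded

/-! ### Dimension from below by reading digits. -/

section Coding

variable {m : ℕ} [NeZero m]

omit [NeZero m] in
/-- If digit sequences can be read off from the points of `E` at a linear rate, then the dimension
of `E` is bounded below by that rate. -/
theorem le_dimH_of_coding (hm : 2 ≤ m) {E : Set (SymbolicSpace m)} {K q : ℕ} (hK : 2 ≤ K)
    (hq : 1 ≤ q) {κ : ℝ} (F : ℕ → ℕ) (hF : ∀ᶠ i : ℕ in atTop, κ * i ≤ F i)
    (code : (ℕ → Fin K) → SymbolicSpace m) (hE : ∀ x, code x ∈ E)
    (hcode : ∀ x y n, (∀ i < n, (code x).letter i = (code y).letter i) →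
      ∀ j < F (n / q), x j = y j) :
    ENNReal.ofReal (κ * Real.log K / (q * Real.log m)) ≤ dimH E := by
  rcases le_or_gt κ 0 with hκ | hκ
  · rw [ENNReal.ofReal_of_nonpos]
    · exact zero_le
    · exact div_nonpos_of_nonpos_of_nonneg
        (mul_nonpos_of_nonpos_of_nonneg hκ (Real.log_natCast_nonneg _))
        (mul_nonneg (Nat.cast_nonneg _) (Real.log_natCast_nonneg _))
  have hlogm : 0 < Real.log m := Real.log_pos (by exact_mod_cast hm)
  have hlogK : 0 < Real.log K := Real.log_pos (by exact_mod_cast hK)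
  have hm0 : (0 : ℝ) < m := by exact_mod_cast (by omega : 0 < m)
  have hK0 : (0 : ℝ) < K := by exact_mod_cast (by omega : 0 < K)
  have hK1 : (1 : ℝ) ≤ K := by exact_mod_cast (by omega : 1 ≤ K)
  have hq0 : (0 : ℝ) < q := by exact_mod_cast hq
  obtain ⟨i₀, hi₀⟩ := eventually_atTop.1 hF
  have hF' : ∀ i : ℕ, κ * i - κ * i₀ ≤ F i := by
    intro i
    rcases le_total i₀ i with h | h
    · have := hi₀ i h
      have : 0 ≤ κ * i₀ := by positivity
      linarith
    · have h1 : (i : ℝ) ≤ i₀ := by exact_mod_cast h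
      have h2 : (0 : ℝ) ≤ F i := Nat.cast_nonneg _
      nlinarith
  have hinj : Function.Injective code := by
    intro x y hxy
    funext j
    obtain ⟨i, hi⟩ := exists_nat_gt ((j + κ * i₀) / κ)
    rw [div_lt_iff₀ hκ] at hi
    refine hcode x y (i * q) (fun _ _ => by rw [hxy]) j ?_
    rw [Nat.mul_div_cancel _ (by omega)]
    have h1 : (j : ℝ) < F i := by linarith [hF' i]
    exact_mod_cast h1
  have : Nonempty (ℕ → Fin K) := ⟨fun _ => ⟨0, by omega⟩⟩
  -- Decode a point and evaluate its digits in base K.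
  set f : SymbolicSpace m → ℝ := fun ω => Real.ofDigits (Function.invFun code ω) with hf
  have hfcode : ∀ x, f (code x) = Real.ofDigits x := fun x => by
    rw [hf]
    simp only
    rw [Function.leftInverse_invFun hinj x]
  set r : ℝ := κ * Real.log K / (q * Real.log m) with hr
  have hr0 : 0 < r := by positivity
  set C : ℝ := (K : ℝ) ^ (κ * (1 + i₀)) with hC
  have hC0 : 0 ≤ C := by positivity
  -- Agreement on n letters fixes about κn/q digits, so values differ by about K^{-κn/q} =
  -- (m^{-n})^r. The constant C covers the rounding of n/q and the initial i₀ cells.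
  have hhold : HolderOnWith C.toNNReal r.toNNReal f (Set.range code) := by
    rintro _ ⟨x, rfl⟩ _ ⟨y, rfl⟩
    by_cases hxy : code x = code y
    · rw [hxy]
      simp
    obtain ⟨n, hdist, hagree⟩ := exists_dist_eq hxy
    rw [hfcode, hfcode, edist_dist, edist_dist, Real.coe_toNNReal _ hr0.le,
      ENNReal.ofReal_rpow_of_nonneg dist_nonneg hr0.le]
    change _ ≤ ENNReal.ofReal C * _
    rw [← ENNReal.ofReal_mul hC0]
    refine ENNReal.ofReal_le_ofReal ?_
    rw [Real.dist_eq, hdist]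
    refine (Real.abs_ofDigits_sub_ofDigits_le (hcode x y n hagree)).trans ?_
    have hfloor : ((n : ℝ) + 1) / q - 1 ≤ (n / q : ℕ) := by
      have h1 : n + 1 ≤ q * (n / q + 1) := Nat.lt_mul_div_succ n (by omega)
      have h2 : ((n : ℝ) + 1) ≤ q * ((n / q : ℕ) + 1) := by exact_mod_cast h1
      rw [sub_le_iff_le_add, div_le_iff₀ hq0]
      linarith
    have hexp : κ * ((n : ℝ) + 1) / q - κ * (1 + i₀) ≤ F (n / q) := by
      have h1 := mul_le_mul_of_nonneg_left hfloor hκ.le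
      have h2 := hF' (n / q)
      rw [mul_sub, ← mul_div_assoc] at h1
      linarith
    rw [hC, ← Real.rpow_natCast, ← Real.rpow_natCast, ← Real.rpow_mul (by positivity),
      ← Real.rpow_neg hK0.le, Real.inv_rpow hm0.le, ← Real.rpow_neg hm0.le,
      Real.rpow_def_of_pos hK0, Real.rpow_def_of_pos hK0, Real.rpow_def_of_pos hm0, ← Real.exp_add,
      Real.exp_le_exp]
    have hrm : Real.log m * -(((n + 1 : ℕ) : ℝ) * r) = - (Real.log K * (κ * ((n : ℝ) + 1) / q)) := by
      rw [hr]
      push_cast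
      field_simp
    rw [hrm]
    nlinarith [mul_le_mul_of_nonneg_left hexp hlogK.le]
  -- Every real in [0, 1] has a base-K expansion, so the image has dimension 1 and the Hölder
  -- exponent r bounds the dimension of the domain.
  have himage : Set.Icc (0 : ℝ) 1 ⊆ f '' Set.range code := by
    intro t ht
    obtain ⟨x, -, rfl⟩ := Real.ofDigits_SurjOn (by omega : 1 < K) ht
    exact ⟨code x, ⟨x, rfl⟩, hfcode x⟩
  have h1 : (1 : ℝ≥0∞) ≤ dimH (Set.range code) / (r.toNNReal : ℝ≥0∞) := by
    refine le_trans (le_of_eq ?_) ((dimH_mono himage).trans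
      (hhold.dimH_image_le (Real.toNNReal_pos.2 hr0)))
    rw [Real.dimH_of_nonempty_interior] <;> simp
  rw [ENNReal.le_div_iff_mul_le (Or.inl (by simpa using hr0)) (Or.inl ENNReal.coe_ne_top),
    one_mul] at h1
  exact h1.trans (dimH_mono (by rintro _ ⟨x, rfl⟩; exact hE x))

theorem IsCoded.eq_of_agree {σ : Schedule} {ℓ M K : ℕ} {e : Fin K → List (Fin m)}
    (he : Function.Injective e) {x y : ℕ → Fin K} {ω ω' : SymbolicSpace m}
    (h : IsCoded σ ℓ M e x ω) (h' : IsCoded σ ℓ M e y ω') {n : ℕ}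
    (hagree : ∀ i < n, ω.letter i = ω'.letter i) :
    ∀ j < σ.freeCount (n / (ℓ + M)), x j = y j := by
  intro j hj
  obtain ⟨i, hi, hfree, rfl⟩ := σ.exists_free_of_lt_freeCount hj
  apply he
  rw [← h.free i hfree, ← h'.free i hfree, pre_eq_iff]
  intro r hr
  rw [shift_iterate_apply, shift_iterate_apply]
  refine hagree _ ?_
  have h1 : (ℓ + M) * (i + 1) ≤ (ℓ + M) * (n / (ℓ + M)) := Nat.mul_le_mul_left _ hi
  have h2 := Nat.mul_div_le n (ℓ + M)
  rw [mul_add] at h1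
  omega

end Coding

/-! ### Auxiliary limits. -/

section Limits

theorem liminf_ofReal_eq {g : ℕ → ℝ} {a : ℝ} (ha : 0 ≤ a)
    (h1 : ∀ ε > 0, ∀ᶠ n in atTop, a - ε ≤ g n) (h2 : ∀ ε > 0, ∃ᶠ n in atTop, g n ≤ a + ε) :
    liminf (fun n => ENNReal.ofReal (g n)) atTop = ENNReal.ofReal a := by
  apply le_antisymm
  · refine ENNReal.le_of_forall_pos_le_add fun ε hε _ => ?_
    refine (liminf_le_of_frequently_le' ((h2 ε (by exact_mod_cast hε)).mono fun n hn =>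
      ENNReal.ofReal_le_ofReal hn)).trans (le_of_eq ?_)
    rw [ENNReal.ofReal_add ha ε.coe_nonneg, ENNReal.ofReal_coe_nnreal]
  · refine ENNReal.le_of_forall_pos_le_add fun ε hε _ => ?_
    have : ENNReal.ofReal (a - ε) ≤ liminf (fun n => ENNReal.ofReal (g n)) atTop :=
      le_liminf_of_le (by isBoundedDefault) ((h1 ε (by exact_mod_cast hε)).mono fun n hn =>
        ENNReal.ofReal_le_ofReal hn)
    refine le_trans ?_ (add_le_add_left this _)
    rw [← ENNReal.ofReal_coe_nnreal (p := ε)]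
    exact (ENNReal.ofReal_le_ofReal (by linarith)).trans ENNReal.ofReal_add_le

theorem limsup_ofReal_eq {g : ℕ → ℝ} {b : ℝ} (hb : 0 ≤ b)
    (h1 : ∀ ε > 0, ∀ᶠ n in atTop, g n ≤ b + ε) (h2 : ∀ ε > 0, ∃ᶠ n in atTop, b - ε ≤ g n) :
    limsup (fun n => ENNReal.ofReal (g n)) atTop = ENNReal.ofReal b := by
  apply le_antisymm
  · refine ENNReal.le_of_forall_pos_le_add fun ε hε _ => ?_
    refine (limsup_le_of_le (by isBoundedDefault) ((h1 ε (by exact_mod_cast hε)).mono fun n hn =>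
      ENNReal.ofReal_le_ofReal hn)).trans (le_of_eq ?_)
    rw [ENNReal.ofReal_add hb ε.coe_nonneg, ENNReal.ofReal_coe_nnreal]
  · refine ENNReal.le_of_forall_pos_le_add fun ε hε _ => ?_
    have : ENNReal.ofReal (b - ε) ≤ limsup (fun n => ENNReal.ofReal (g n)) atTop :=
      le_limsup_of_frequently_le' ((h2 ε (by exact_mod_cast hε)).mono fun n hn =>
        ENNReal.ofReal_le_ofReal hn)
    refine le_trans ?_ (add_le_add_left this _)
    rw [← ENNReal.ofReal_coe_nnreal (p := ε)]
    exact (ENNReal.ofReal_le_ofReal (by linarith)).trans ENNReal.ofReal_add_le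

theorem exists_mem_Ico_of_le {P : ℕ → ℕ} (hP : StrictMono P) {k n : ℕ} (h : P k ≤ n) :
    ∃ j ≥ k, P j ≤ n ∧ n < P (j + 1) := by
  classical
  have hbound : ∀ j, P j ≤ n → j ≤ n := fun j hj => hP.le_apply.trans hj
  refine ⟨Nat.findGreatest (fun j => P j ≤ n) n, Nat.le_findGreatest (hbound k h) h,
    Nat.findGreatest_spec (P := fun j => P j ≤ n) (hbound k h) h, ?_⟩
  by_contra! hle
  have := Nat.le_findGreatest (P := fun j => P j ≤ n) (hbound _ hle) hle
  omega

theorem eventually_of_Ico {P : ℕ → ℕ} (hP : StrictMono P) {p : ℕ → Prop}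
    (h : ∀ᶠ k in atTop, ∀ n, P k ≤ n → n < P (k + 1) → p n) : ∀ᶠ n in atTop, p n := by
  obtain ⟨k, hk⟩ := eventually_atTop.1 h
  filter_upwards [eventually_ge_atTop (P k)] with n hn
  obtain ⟨j, hj, h1, h2⟩ := exists_mem_Ico_of_le hP hn
  exact hk j hj n h1 h2

/-- A linear recursion `x (k + 1) ≤ ρ k * x k + α k` with `ρ k → r < 1` and `α k → a`
is asymptotically bounded by its fixed point. -/
theorem eventually_le_of_recursion {x ρ α : ℕ → ℝ} {r a s : ℝ} (hx : ∀ k, 0 ≤ x k)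
    (hr0 : 0 ≤ r) (hr : r < 1) (hρ : Tendsto ρ atTop (𝓝 r)) (hα : Tendsto α atTop (𝓝 a))
    (hrec : ∀ k, x (k + 1) ≤ ρ k * x k + α k) (hs : a / (1 - r) < s) :
    ∀ᶠ k in atTop, x k ≤ s := by
  have hc : ContinuousAt (fun ε : ℝ => (a + ε) / (1 - (r + ε)) + ε) 0 := by
    have : 1 - (r + 0) ≠ 0 := by rw [add_zero]; linarith
    fun_prop (disch := assumption)
  have hev : ∀ᶠ ε : ℝ in 𝓝[>] 0, (a + ε) / (1 - (r + ε)) + ε < s :=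
    (hc.eventually_lt continuousAt_const (by simpa using hs)).filter_mono nhdsWithin_le_nhds
  obtain ⟨ε, hε, hε0, hε1⟩ := (hev.and (Ioo_mem_nhdsGT (show 0 < 1 - r by linarith))).exists
  set ρ' := r + ε with hρ'
  set fp := (a + ε) / (1 - ρ') with hfp
  have h1 : 0 < 1 - ρ' := by linarith
  have hfix : ρ' * fp + (a + ε) = fp := by
    rw [hfp]
    field_simp
    ring
  obtain ⟨k₀, hk₀⟩ := eventually_atTop.1 ((hρ.eventually_le_const (show r < ρ' by linarith)).and
    (hα.eventually_le_const (show a < a + ε by linarith)))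
  have hstep : ∀ k ≥ k₀, x (k + 1) ≤ ρ' * x k + (a + ε) := fun k hk => by
    have := mul_le_mul_of_nonneg_right (hk₀ k hk).1 (hx k)
    linarith [hrec k, (hk₀ k hk).2]
  -- The excess over the perturbed fixed point shrinks at least by the factor ρ' < 1 at each step.
  have hpow : ∀ j, x (k₀ + j) - fp ≤ ρ' ^ j * |x k₀ - fp| := by
    intro j
    induction j with
    | zero => simpa using le_abs_self (x k₀ - fp)
    | succ j ih =>
      have h2 := hstep (k₀ + j) (by omega)
      have h3 := mul_le_mul_of_nonneg_left ih (show 0 ≤ ρ' by linarith)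
      rw [pow_succ', mul_assoc, ← add_assoc]
      linarith
  have hlim : Tendsto (fun j : ℕ => ρ' ^ j * |x k₀ - fp|) atTop (𝓝 0) := by
    have := (tendsto_pow_atTop_nhds_zero_of_lt_one (show 0 ≤ ρ' by linarith)
      (show ρ' < 1 by linarith)).mul_const |x k₀ - fp|
    rwa [zero_mul] at this
  obtain ⟨j₀, hj₀⟩ := eventually_atTop.1 (hlim.eventually_le_const hε0)
  filter_upwards [eventually_ge_atTop (k₀ + j₀)] with k hk
  have h2 := hpow (k - k₀)
  rw [show k₀ + (k - k₀) = k by omega] at h2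
  linarith [hj₀ (k - k₀) (by omega)]

end Limits

/-! ### Growth rates and free-cell density along a schedule. -/

section Asymptotics

variable {m : ℕ} [NeZero m]

theorem lowerL_upperL_eq {ω : SymbolicSpace m} {R : ℕ → ℕ} (hR : ∀ n, maxRun ω n = R n) :
    lowerL ω = liminf (fun n : ℕ => ENNReal.ofReal ((R n : ℝ) / n)) atTop ∧
      upperL ω = limsup (fun n : ℕ => ENNReal.ofReal ((R n : ℝ) / n)) atTop := by
  have : (fun n : ℕ => ((maxRun ω n : ℕ∞) : ℝ≥0∞) / (n : ℝ≥0∞)) =ᶠ[atTop]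
      fun n : ℕ => ENNReal.ofReal ((R n : ℝ) / n) := by
    filter_upwards [eventually_ge_atTop 1] with n hn
    exact ratio_eq_coe hn (hR n)
  exact ⟨liminf_congr this, limsup_congr this⟩

variable {σ : Schedule}

theorem Schedule.tendsto_N (σ : Schedule) : Tendsto (fun k => (σ.N k : ℝ)) atTop atTop :=
  tendsto_natCast_atTop_atTop.comp σ.strictMono_N.tendsto_atTop

theorem Schedule.eventually_le_mul_N (σ : Schedule) {δ : ℝ} (hδ : 0 < δ) (C : ℝ) :
    ∀ᶠ k in atTop, C ≤ δ * σ.N k :=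
  (σ.tendsto_N.const_mul_atTop hδ).eventually_ge_atTop C

/-- Up to bounded errors L_n equals q T_k from the start of block k until just before block k + 1.
So L_n/n peaks near T_k/N_k at the start and drops to T_k/N_{k+1} at the end. -/
theorem IsCoded.lowerL_upperL {ℓ M K : ℕ} {e : Fin K → List (Fin m)} {x : ℕ → Fin K}
    {ω : SymbolicSpace m} (h : IsCoded σ ℓ M e x ω) (he : ∀ d, e d ≠ List.replicate ℓ 0)
    (hℓ : 1 ≤ ℓ) {a b : ℝ} (ha : 0 ≤ a) (hb : 0 ≤ b)
    (hTb : Tendsto (fun k => (σ.T k : ℝ) / σ.N k) atTop (𝓝 b))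
    (hTa : Tendsto (fun k => (σ.T k : ℝ) / σ.N (k + 1)) atTop (𝓝 a)) :
    lowerL ω = ENNReal.ofReal a ∧ upperL ω = ENNReal.ofReal b := by
  choose R hR using (h.notEventuallyZero he hℓ).exists_maxRun
  obtain ⟨e1, e2⟩ := lowerL_upperL_eq hR
  rw [e1, e2]
  have hq1 : (1 : ℝ) ≤ ((ℓ + M : ℕ) : ℝ) := by exact_mod_cast (by omega : 1 ≤ ℓ + M)
  have hlow : ∀ k n, (ℓ + M) * σ.N k ≤ n → ((ℓ + M : ℕ) : ℝ) * σ.T k - M ≤ R n := by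
    intro k n hn
    have h1 := h.le_maxRun hℓ hn
    rw [hR] at h1
    have h2 : (ℓ + M) * σ.T k ≤ R n + M := by
      have h3 : (ℓ + M) * σ.T k - M ≤ R n := by exact_mod_cast h1
      omega
    have h4 : ((ℓ + M : ℕ) : ℝ) * σ.T k ≤ R n + M := by exact_mod_cast h2
    linarith
  have hupp : ∀ k n, n < (ℓ + M) * (σ.N (k + 1) - 1) →
      (R n : ℝ) ≤ ((ℓ + M : ℕ) : ℝ) * (σ.T k + 2) := by
    intro k n hn
    have h1 := h.maxRun_le he hℓ hn
    rw [hR] at h1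
    exact_mod_cast h1
  have hNpos : ∀ k, (0 : ℝ) < σ.N k := fun k => by exact_mod_cast σ.one_le_N k
  have hM0 : (0 : ℝ) ≤ M := Nat.cast_nonneg M
  set q : ℕ := ℓ + M with hq
  have hqpos : 0 < q := by omega
  have hTb1 : ∀ ε > 0, ∀ᶠ k in atTop, (σ.T k : ℝ) ≤ (b + ε) * σ.N k := fun ε hε => by
    filter_upwards [hTb.eventually_le_const (show b < b + ε by linarith)] with k hk
    exact (div_le_iff₀ (hNpos k)).1 hk
  have hTb2 : ∀ ε > 0, ∀ᶠ k in atTop, (b - ε) * σ.N k ≤ σ.T k := fun ε hε => by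
    filter_upwards [hTb.eventually_const_le (show b - ε < b by linarith)] with k hk
    exact (le_div_iff₀ (hNpos k)).1 hk
  have hTa1 : ∀ ε > 0, ∀ᶠ k in atTop, (σ.T k : ℝ) ≤ (a + ε) * σ.N (k + 1) := fun ε hε => by
    filter_upwards [hTa.eventually_le_const (show a < a + ε by linarith)] with k hk
    exact (div_le_iff₀ (hNpos _)).1 hk
  have hTa2 : ∀ ε > 0, ∀ᶠ k in atTop, (a - ε) * σ.N (k + 1) ≤ σ.T k := fun ε hε => by
    filter_upwards [hTa.eventually_const_le (show a - ε < a by linarith)] with k hk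
    exact (le_div_iff₀ (hNpos _)).1 hk
  constructor
  · refine liminf_ofReal_eq ha (fun ε hε => ?_) (fun ε hε => ?_)
    · rcases le_or_gt (a - ε) 0 with hneg | hpos
      · exact Eventually.of_forall fun n => hneg.trans (by positivity)
      refine eventually_of_Ico (P := fun k => q * σ.N k)
        (fun i j hij => Nat.mul_lt_mul_of_pos_left (σ.strictMono_N hij) hqpos) ?_
      filter_upwards [hTa2 (ε / 2) (by linarith),
        (tendsto_add_atTop_nat 1).eventually (σ.eventually_le_mul_N (half_pos hε) M),
        eventually_ge_atTop 1] with k hk1 hk2 hk3 n hn1 hn2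
      have hn0 : (0 : ℝ) < n := by
        have : 0 < q * σ.N k := Nat.mul_pos hqpos (σ.one_le_N k)
        exact_mod_cast this.trans_le hn1
      rw [le_div_iff₀ hn0]
      have h1 := hlow k n hn1
      have h2 : (n : ℝ) ≤ q * σ.N (k + 1) := by exact_mod_cast hn2.le
      have h3 := mul_le_mul_of_nonneg_left h2 hpos.le
      have h4 : (q : ℝ) * (M + (a - ε) * σ.N (k + 1)) ≤ q * σ.T k :=
        mul_le_mul_of_nonneg_left (by linarith) (by linarith)
      nlinarith
    -- The witness is the last n for which the bound with index k is available.
    · have htend : Tendsto (fun k => q * (σ.N (k + 1) - 1) - 1) atTop atTop := by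
        refine tendsto_atTop_mono (fun k => ?_) (tendsto_sub_atTop_nat 1)
        have h1 := σ.strictMono_N.le_apply (x := k + 1)
        have h2 : σ.N (k + 1) - 1 ≤ q * (σ.N (k + 1) - 1) := Nat.le_mul_of_pos_left _ hqpos
        omega
      refine htend.frequently (Eventually.frequently ?_)
      filter_upwards [hTa1 (ε / 2) (by linarith), (tendsto_add_atTop_nat 1).eventually
        (σ.eventually_le_mul_N (half_pos hε) (2 + (a + ε) * 2)), eventually_ge_atTop 2]
        with k hk1 hk2 hk3
      have h1 := σ.strictMono_N.le_apply (x := k + 1)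
      have h2 : σ.N (k + 1) - 1 ≤ q * (σ.N (k + 1) - 1) := Nat.le_mul_of_pos_left _ hqpos
      have h3 := hupp k (q * (σ.N (k + 1) - 1) - 1) (by omega)
      refine div_le_of_le_mul₀ (by positivity) (by positivity) (h3.trans ?_)
      rw [Nat.cast_sub (by omega), Nat.cast_mul, Nat.cast_sub (by omega), Nat.cast_one]
      have h4 : (σ.T k : ℝ) + 2 ≤ (a + ε) * (σ.N (k + 1) - 2) := by linarith
      have h5 := mul_le_mul_of_nonneg_left h4 (show (0 : ℝ) ≤ q by linarith)
      have h6 : 0 ≤ a + ε := by linarith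
      nlinarith
  · refine limsup_ofReal_eq hb (fun ε hε => ?_) (fun ε hε => ?_)
    -- The intervals start one cell early, matching the range of validity of the upper bound on
    -- runs.
    · refine eventually_of_Ico (P := fun k => q * (σ.N k - 1)) (fun i j hij =>
        Nat.mul_lt_mul_of_pos_left (by
          have := σ.strictMono_N hij
          have := σ.one_le_N i
          omega) hqpos) ?_
      filter_upwards [hTb1 (ε / 2) (by linarith),
        σ.eventually_le_mul_N (half_pos hε) (2 + (b + ε))] with k hk1 hk2 n hn1 hn2
      refine div_le_of_le_mul₀ (by positivity) (by positivity) ((hupp k n hn2).trans ?_)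
      have h1 : (q : ℝ) * (σ.N k - 1) ≤ n := by
        have : ((q * (σ.N k - 1) : ℕ) : ℝ) ≤ n := by exact_mod_cast hn1
        rwa [Nat.cast_mul, Nat.cast_sub (σ.one_le_N k), Nat.cast_one] at this
      have h2 := mul_le_mul_of_nonneg_left h1 (show 0 ≤ b + ε by linarith)
      have h4 : (σ.T k : ℝ) + 2 ≤ (b + ε) * (σ.N k - 1) := by linarith
      have h5 := mul_le_mul_of_nonneg_left h4 (show (0 : ℝ) ≤ q by linarith)
      linarith
    · have htend : Tendsto (fun k => q * σ.N k) atTop atTop := by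
        refine tendsto_atTop_mono (fun k => ?_) tendsto_id
        exact σ.strictMono_N.le_apply.trans (Nat.le_mul_of_pos_left _ hqpos)
      refine htend.frequently (Eventually.frequently ?_)
      filter_upwards [hTb2 (ε / 2) (by linarith), σ.eventually_le_mul_N (half_pos hε) M]
        with k hk1 hk2
      have h1 := hlow k _ le_rfl
      have h2 := hNpos k
      have h3 : (0 : ℝ) < q := by linarith
      rw [Nat.cast_mul, le_div_iff₀ (by positivity)]
      have h4 : (q : ℝ) * (M + (b - ε) * σ.N k) ≤ q * σ.T k :=
        mul_le_mul_of_nonneg_left (by linarith) (by linarith)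
      nlinarith

/-- The proportion of free cells is worst at the end of block k: about (1 - s)N_k free cells out of
(1 + b)N_k. -/
theorem Schedule.eventually_le_freeCount (σ : Schedule) {b s c : ℝ} (hb : 0 ≤ b) (hs : 0 ≤ s)
    (hTb : Tendsto (fun k => (σ.T k : ℝ) / σ.N k) atTop (𝓝 b))
    (hsum : ∀ s' > s, ∀ᶠ k in atTop, (∑ j ∈ Finset.range k, (σ.T j : ℝ)) / σ.N k ≤ s')
    (hc : c < (1 - s) / (1 + b)) : ∀ᶠ i : ℕ in atTop, c * i ≤ σ.freeCount i := by
  have hNpos : ∀ k, (0 : ℝ) < σ.N k := fun k => by exact_mod_cast σ.one_le_N k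
  rcases le_or_gt c 0 with hneg | hpos
  · exact Eventually.of_forall fun i =>
      (mul_nonpos_of_nonpos_of_nonneg hneg (Nat.cast_nonneg i)).trans (Nat.cast_nonneg _)
  rw [lt_div_iff₀ (by linarith)] at hc
  obtain ⟨ε, hε0, hε⟩ : ∃ ε > 0, c * (1 + (b + ε)) ≤ 1 - (s + ε) := by
    refine ⟨(1 - s - c * (1 + b)) / (1 + c), div_pos (by linarith) (by linarith), ?_⟩
    have : (1 - s - c * (1 + b)) / (1 + c) * (1 + c) = 1 - s - c * (1 + b) := by
      field_simp
    linarith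
  refine eventually_of_Ico σ.strictMono_N ?_
  filter_upwards [hsum (s + ε) (by linarith),
    hTb.eventually_le_const (show b < b + ε by linarith)] with k hk1 hk2 i hi1 hi2
  rw [div_le_iff₀ (hNpos k)] at hk1 hk2
  have h1 : (i : ℝ) ≤ σ.freeCount i +
      (∑ j ∈ Finset.range k, (σ.T j : ℝ) + min (σ.T k : ℝ) (i - σ.N k)) := by
    have := σ.le_freeCount_add hi2
    rw [← Nat.cast_sub hi1]
    exact_mod_cast this
  have hN := hNpos k
  -- Up to the end of the block no new free cell is needed; beyond it each further cell is free,
  -- which suffices because c ≤ 1.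
  rcases le_total (i : ℝ) (σ.N k * (1 + (b + ε))) with h | h
  · have h2 := min_le_right (σ.T k : ℝ) (i - σ.N k)
    nlinarith
  · have h2 := min_le_left (σ.T k : ℝ) (i - σ.N k)
    have h3 : c ≤ 1 := by nlinarith
    nlinarith [mul_le_mul_of_nonneg_left h (show 0 ≤ 1 - c by linarith)]

/-- Factorials serve for r = 0, rounded powers of 1/r for r > 0. -/
theorem exists_seq_ratio {r : ℝ} (hr0 : 0 ≤ r) (hr : r < 1) :
    ∃ N : ℕ → ℕ, (∀ k, 1 ≤ N k) ∧ Tendsto N atTop atTop ∧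
      Tendsto (fun k => (N k : ℝ) / N (k + 1)) atTop (𝓝 r) := by
  rcases hr0.eq_or_lt with rfl | hpos
  · refine ⟨Nat.factorial, Nat.factorial_pos, tendsto_atTop_mono Nat.self_le_factorial tendsto_id,
      (tendsto_one_div_add_atTop_nhds_zero_nat (𝕜 := ℝ)).congr fun k => ?_⟩
    have : (k.factorial : ℝ) ≠ 0 := by exact_mod_cast Nat.factorial_ne_zero k
    rw [Nat.factorial_succ]
    push_cast
    field_simp
  · have hβ : 1 < r⁻¹ := (one_lt_inv₀ hpos).2 hr
    have hβ0 : ∀ k, (0 : ℝ) < r⁻¹ ^ k := fun k => by positivity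
    have htop := tendsto_pow_atTop_atTop_of_one_lt hβ
    have hc : Tendsto (fun k : ℕ => ((⌈r⁻¹ ^ k⌉₊ : ℕ) : ℝ) / r⁻¹ ^ k) atTop (𝓝 1) :=
      (tendsto_nat_ceil_div_atTop (R := ℝ)).comp htop
    refine ⟨fun k => ⌈r⁻¹ ^ k⌉₊, fun k => Nat.one_le_iff_ne_zero.2 (Nat.ceil_pos.2 (hβ0 k)).ne',
      tendsto_nat_ceil_atTop.comp htop, ?_⟩
    have h2 := ((hc.div (hc.comp (tendsto_add_atTop_nat 1)) one_ne_zero).mul_const r)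
    rw [div_one, one_mul] at h2
    refine h2.congr fun k => ?_
    have h3 : ((⌈r⁻¹ ^ (k + 1)⌉₊ : ℕ) : ℝ) ≠ 0 := by
      exact_mod_cast (Nat.ceil_pos.2 (hβ0 (k + 1))).ne'
    have h4 := (hβ0 k).ne'
    simp only [Pi.div_apply, Function.comp_apply]
    rw [pow_succ] at h3 ⊢
    field_simp

/-- The condition r(1 + b) < 1 makes blocks disjoint from some index k₀ on, and the earlier ones are
dropped. The + 1 in T keeps blocks nonempty when b = 0 without changing the limit. -/
theorem exists_schedule {b r : ℝ} (hb : 0 ≤ b) (hr0 : 0 ≤ r) (hr : r * (1 + b) < 1) :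
    ∃ σ : Schedule, Tendsto (fun k => (σ.N k : ℝ) / σ.N (k + 1)) atTop (𝓝 r) ∧
      Tendsto (fun k => (σ.T k : ℝ) / σ.N k) atTop (𝓝 b) := by
  obtain ⟨N, hN1, hNtop, hNr⟩ := exists_seq_ratio hr0 (by nlinarith)
  have hNpos : ∀ k, (0 : ℝ) < N k := fun k => by exact_mod_cast hN1 k
  let T : ℕ → ℕ := fun k => ⌊b * N k⌋₊ + 1
  have hNR : Tendsto (fun k => (N k : ℝ)) atTop atTop := tendsto_natCast_atTop_atTop.comp hNtop
  have hT : Tendsto (fun k => (T k : ℝ) / N k) atTop (𝓝 b) := by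
    have h1 : Tendsto (fun k => b + 1 / (N k : ℝ)) atTop (𝓝 b) := by
      have := (tendsto_inv_atTop_zero.comp hNR).const_add b
      simpa using this
    refine tendsto_of_tendsto_of_tendsto_of_le_of_le tendsto_const_nhds h1 (fun k => ?_) fun k => ?_
    · simp only [T]
      rw [le_div_iff₀ (hNpos k)]
      push_cast
      exact (Nat.lt_floor_add_one _).le
    · simp only [T]
      rw [div_le_iff₀ (hNpos k), add_mul, one_div_mul_cancel (hNpos k).ne']
      push_cast
      have := Nat.floor_le (show 0 ≤ b * N k by have := hNpos k; positivity)
      linarith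
  have hlt : ∀ᶠ k in atTop, N k + T k < N (k + 1) := by
    have h1 : Tendsto (fun k => (N k : ℝ) / N (k + 1) * (1 + (T k : ℝ) / N k)) atTop
        (𝓝 (r * (1 + b))) := hNr.mul (hT.const_add 1)
    filter_upwards [h1.eventually_lt_const hr] with k hk
    have h2 := hNpos k
    have h3 := hNpos (k + 1)
    have h4 : (N k : ℝ) / N (k + 1) * (1 + (T k : ℝ) / N k) = (N k + T k) / N (k + 1) := by
      field_simp
    rw [h4, div_lt_one h3] at hk
    exact_mod_cast hk
  obtain ⟨k₀, hk₀⟩ := eventually_atTop.1 hlt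
  have hmono : Monotone fun k => N (k + k₀) := monotone_nat_of_le_succ fun k => by
    have := hk₀ (k + k₀) (by omega)
    rw [show k + 1 + k₀ = k + k₀ + 1 by omega]
    omega
  refine ⟨⟨fun k => N (k + k₀), fun k => T (k + k₀), fun k => hN1 _, fun k => by simp [T], ?_, ?_⟩,
    ?_, ?_⟩
  · intro i j hij
    have h1 : (N (i + k₀) : ℝ) ≤ N (j + k₀) := by exact_mod_cast hmono hij
    simp only [T]
    gcongr
  · intro k
    have := hk₀ (k + k₀) (by omega)
    rwa [show k + 1 + k₀ = k + k₀ + 1 by omega]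
  · have := hNr.comp (tendsto_add_atTop_nat k₀)
    refine this.congr fun k => ?_
    simp only [Function.comp_apply]
    rw [show k + 1 + k₀ = k + k₀ + 1 by omega]
  · exact hT.comp (tendsto_add_atTop_nat k₀)

/-- The normalised sums satisfy x_{k+1} = (N_k/N_{k+1}) x_k + T_k/N_{k+1}, whose limiting fixed
point is a/(1 - r). -/
theorem Schedule.eventually_sum_le (σ : Schedule) {a r : ℝ} (hr0 : 0 ≤ r) (hr : r < 1)
    (hN : Tendsto (fun k => (σ.N k : ℝ) / σ.N (k + 1)) atTop (𝓝 r))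
    (hTa : Tendsto (fun k => (σ.T k : ℝ) / σ.N (k + 1)) atTop (𝓝 a)) {s : ℝ}
    (hs : a / (1 - r) < s) :
    ∀ᶠ k in atTop, (∑ j ∈ Finset.range k, (σ.T j : ℝ)) / σ.N k ≤ s := by
  refine eventually_le_of_recursion (fun k => by positivity) hr0 hr hN hTa (fun k => le_of_eq ?_) hs
  have h1 : (σ.N k : ℝ) ≠ 0 := by exact_mod_cast (Nat.one_le_iff_ne_zero.1 (σ.one_le_N k))
  have h2 : (σ.N (k + 1) : ℝ) ≠ 0 := by
    exact_mod_cast (Nat.one_le_iff_ne_zero.1 (σ.one_le_N (k + 1)))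
  rw [Finset.sum_range_succ]
  field_simp

end Asymptotics

/-! ### Lower bounds for the dimension and the dimension of the subshift. -/

section LowerBound

variable {m : ℕ} [NeZero m]

/-- Excluding 0^ℓ lets every free cell interrupt a run, at the cost of a single word. -/
theorem exists_words_enumeration {S : Set (SymbolicSpace m)} (hzero : zeroWord m ∈ S) (ℓ : ℕ) :
    ∃ e : Fin ((words S ℓ).ncard - 1) → List (Fin m), Function.Injective e ∧
      (∀ d, e d ∈ words S ℓ) ∧ ∀ d, e d ≠ List.replicate ℓ 0 := by
  have hmem : List.replicate ℓ (0 : Fin m) ∈ words S ℓ := ⟨zeroWord m, hzero, pre_zeroWord ℓ⟩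
  have hfin : (words S ℓ \ {List.replicate ℓ 0}).Finite := (words_finite S ℓ).sdiff
  have hcard : hfin.toFinset.card = (words S ℓ).ncard - 1 := by
    rw [← Set.ncard_eq_toFinset_card _ hfin, Set.ncard_sdiff_singleton_of_mem hmem]
  let E := (hfin.toFinset.equivFin.trans (finCongr hcard)).symm
  have hE : ∀ d, (E d : List (Fin m)) ∈ words S ℓ \ {List.replicate ℓ 0} := fun d =>
    hfin.mem_toFinset.1 (E d).2
  exact ⟨fun d => E d, Subtype.val_injective.comp E.injective, fun d => (hE d).1,
    fun d => (hE d).2⟩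

theorem levelSetStar_psiZero (hm : 2 ≤ m) (S : Set (SymbolicSpace m)) (a b : ℝ≥0∞) :
    levelSetStar S (psiZero m) a b = {ω | ω ∈ S ∧ lowerL ω = a ∧ upperL ω = b} := by
  have h : ∀ ω : SymbolicSpace m, ratio (psiZero m) ω =
      fun N : ℕ => ((maxRun ω N : ℕ∞) : ℝ≥0∞) / (N : ℝ≥0∞) := fun ω =>
    funext fun N => ratio_psiZero hm ω N
  simp only [levelSetStar, h]
  rfl

theorem levelSet_psiZero (hm : 2 ≤ m) (S : Set (SymbolicSpace m)) (a b : ℝ≥0∞) :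
    levelSet S (psiZero m) a b = {ω | ω ∈ S ∧ a ≤ lowerL ω ∧ upperL ω = b} := by
  have h : ∀ ω : SymbolicSpace m, ratio (psiZero m) ω =
      fun N : ℕ => ((maxRun ω N : ℕ∞) : ℝ≥0∞) / (N : ℝ≥0∞) := fun ω =>
    funext fun N => ratio_psiZero hm ω N
  simp only [levelSet, h]
  rfl

theorem le_dimH_levels_of_words (hm : 2 ≤ m) {S : Set (SymbolicSpace m)} (hS : IsSubshift S)
    {M ℓ : ℕ}
    (hspec : ∀ u ∈ language S, ∀ v ∈ language S, ∃ w ∈ words S M, u ++ w ++ v ∈ language S)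
    (hzero : zeroWord m ∈ S) (hℓ : 1 ≤ ℓ) (hw : 3 ≤ (words S ℓ).ncard) {a b r : ℝ} (hb : 0 ≤ b)
    (hr0 : 0 ≤ r) (hr : r * (1 + b) < 1) (hrb : r * b = a) {c : ℝ}
    (hc : c < (1 - a / (1 - r)) / (1 + b)) :
    ENNReal.ofReal (c * Real.log ((words S ℓ).ncard - 1 : ℕ) / ((ℓ + M : ℕ) * Real.log m)) ≤
      dimH {ω | ω ∈ S ∧ lowerL ω = ENNReal.ofReal a ∧ upperL ω = ENNReal.ofReal b} := by
  have ha : 0 ≤ a := hrb ▸ mul_nonneg hr0 hb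
  have hr1 : r < 1 := by nlinarith
  obtain ⟨σ, hN, hTb⟩ := exists_schedule hb hr0 hr
  have hTa : Tendsto (fun k => (σ.T k : ℝ) / σ.N (k + 1)) atTop (𝓝 a) := by
    have := hN.mul hTb
    rw [hrb] at this
    refine this.congr fun k => ?_
    have h1 : (σ.N k : ℝ) ≠ 0 := by exact_mod_cast (Nat.one_le_iff_ne_zero.1 (σ.one_le_N k))
    field_simp
  obtain ⟨e, he, heS, hez⟩ := exists_words_enumeration hzero ℓ
  choose code hcodeS hcode using exists_isCoded hm hS hspec hzero σ hℓ e heS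
  refine le_dimH_of_coding hm (by omega) (by omega) σ.freeCount
    (σ.eventually_le_freeCount hb (div_nonneg ha (by linarith)) hTb
      (fun s' hs' => σ.eventually_sum_le hr0 hr1 hN hTa hs') hc) code
    (fun x => ⟨hcodeS x, (hcode x).lowerL_upperL hez hℓ ha hb hTb hTa⟩)
    fun x y n hagree => (hcode x).eq_of_agree he (hcode y) hagree

/-- Let ℓ → ∞: the gaps and the excluded word cost nothing in the limit. Keeping r as a parameter
with rb = a, instead of a/b, includes a = b = 0. -/
theorem le_dimH_levels (hm : 2 ≤ m) {S : Set (SymbolicSpace m)} (hS : IsSubshift S)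
    (hspec : HasSpecification S) (hent : 0 < topEntropy S) (hzero : zeroWord m ∈ S) {a b r : ℝ}
    (hb : 0 ≤ b) (hr0 : 0 ≤ r) (hr : r * (1 + b) < 1) (hrb : r * b = a) :
    ENNReal.ofReal ((1 - a / (1 - r)) / (1 + b) * (topEntropy S / Real.log m)) ≤
      dimH {ω | ω ∈ S ∧ lowerL ω = ENNReal.ofReal a ∧ upperL ω = ENNReal.ofReal b} := by
  obtain ⟨M, hspec⟩ := hspec
  have hlogm : 0 < Real.log m := Real.log_pos (by exact_mod_cast hm)
  have hh := tendsto_topEntropy hS ⟨_, hzero⟩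
  set w : ℕ → ℕ := fun n => (words S n).ncard with hwdef
  have hlarge : ∀ᶠ n : ℕ in atTop, 3 ≤ w n := by
    have hdiv : Tendsto (fun n : ℕ => Real.log 3 / (n : ℝ)) atTop (𝓝 0) :=
      tendsto_const_div_atTop_nhds_zero_nat _
    filter_upwards [hdiv.eventually_lt hh hent, eventually_ge_atTop 1] with n hn h1
    have hn0 : (0 : ℝ) < n := by exact_mod_cast h1
    rw [div_lt_div_iff_of_pos_right hn0] at hn
    by_contra! hlt
    refine absurd hn (not_lt.2 ?_)
    rcases Nat.eq_zero_or_pos (w n) with h0 | hpos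
    · have : ((words S n).ncard : ℝ) = 0 := by exact_mod_cast h0
      rw [this, Real.log_zero]
      exact Real.log_nonneg (by norm_num)
    · exact Real.log_le_log (by exact_mod_cast hpos) (by exact_mod_cast hlt.le)
  -- The term log 2 comes from log(w - 1) ≥ log w - log 2, valid since w ≥ 2.
  have hlim : Tendsto (fun n : ℕ => Real.log (w n) / n * ((n : ℝ) / (n + M)) -
      Real.log 2 * ((n : ℝ) + M)⁻¹) atTop (𝓝 (topEntropy S)) := by
    have h1 : Tendsto (fun n : ℕ => (n : ℝ) / (n + M)) atTop (𝓝 1) :=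
      tendsto_natCast_div_add_atTop (M : ℝ)
    have h2 : Tendsto (fun n : ℕ => ((n : ℝ) + M)⁻¹) atTop (𝓝 0) :=
      tendsto_inv_atTop_zero.comp (tendsto_atTop_add_const_right _ _ tendsto_natCast_atTop_atTop)
    simpa using (hh.mul h1).sub (h2.const_mul (Real.log 2))
  set κ := (1 - a / (1 - r)) / (1 + b) with hκ
  have hpos : ∀ c < κ, 0 ≤ c → ENNReal.ofReal (c * (topEntropy S / Real.log m)) ≤
      dimH {ω | ω ∈ S ∧ lowerL ω = ENNReal.ofReal a ∧ upperL ω = ENNReal.ofReal b} := by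
    intro c hc hc0
    refine le_of_tendsto (ENNReal.tendsto_ofReal ((hlim.div_const (Real.log m)).const_mul c)) ?_
    filter_upwards [hlarge, eventually_ge_atTop 1] with n hn h1
    refine le_trans (ENNReal.ofReal_le_ofReal ?_)
      (le_dimH_levels_of_words hm hS hspec hzero h1 hn hb hr0 hr hrb hc)
    rw [mul_div_assoc]
    refine mul_le_mul_of_nonneg_left ?_ hc0
    have hn0 : (0 : ℝ) < n := by exact_mod_cast h1
    have hnM : (0 : ℝ) < n + M := by positivity
    have h2 : Real.log (w n) / n * ((n : ℝ) / (n + M)) - Real.log 2 * ((n : ℝ) + M)⁻¹ =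
        (Real.log (w n) - Real.log 2) / (n + M) := by
      field_simp
    rw [h2, div_div]
    push_cast
    have h3 : Real.log (w n) - Real.log 2 ≤ Real.log (w n - 1 : ℕ) := by
      have hw0 : (0 : ℝ) < w n := by exact_mod_cast (by omega : 0 < w n)
      rw [← Real.log_div hw0.ne' (by norm_num)]
      refine Real.log_le_log (by positivity) ?_
      rw [div_le_iff₀ (by norm_num)]
      exact_mod_cast (by omega : w n ≤ (w n - 1) * 2)
    gcongr
  rcases le_or_gt κ 0 with hκ0 | hκ0
  · rw [ENNReal.ofReal_of_nonpos]
    · exact zero_le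
    · exact mul_nonpos_of_nonpos_of_nonneg hκ0 (by positivity)
  · have hc : Tendsto (fun c : ℝ => ENNReal.ofReal (c * (topEntropy S / Real.log m))) (𝓝[<] κ)
        (𝓝 (ENNReal.ofReal (κ * (topEntropy S / Real.log m)))) :=
      ENNReal.tendsto_ofReal ((tendsto_id.mul_const _).mono_left nhdsWithin_le_nhds)
    refine le_of_tendsto hc ?_
    filter_upwards [Ioo_mem_nhdsLT hκ0] with c hc
    exact hpos c hc.2 hc.1.le

theorem dimH_subshift (hm : 2 ≤ m) {S : Set (SymbolicSpace m)} (hS : IsSubshift S)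
    (hspec : HasSpecification S) (hent : 0 < topEntropy S) (hzero : zeroWord m ∈ S) :
    dimH S = ENNReal.ofReal (topEntropy S / Real.log m) := by
  refine le_antisymm (dimH_subshift_le hm hS ⟨_, hzero⟩) ?_
  have h := le_dimH_levels hm hS hspec hent hzero (a := 0) (b := 0) (r := 0) le_rfl le_rfl
    (by norm_num) (by norm_num)
  simp only [sub_zero, div_one, add_zero, one_mul] at h
  exact h.trans (dimH_mono fun ω hω => hω.1)

end LowerBound

/-! ### Assembling the coefficient, the level sets and the estimate with ϱ. -/

section Main

variable {m : ℕ} [NeZero m]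

theorem levelSet_eq_empty (hm : 2 ≤ m) (S : Set (SymbolicSpace m)) {a : ℝ} (ha1 : a < 1)
    {b : ℝ≥0∞} (hb : b < ENNReal.ofReal (a / (1 - a))) :
    levelSet S (psiZero m) (ENNReal.ofReal a) b = ∅ := by
  rw [levelSet_psiZero hm, Set.eq_empty_iff_forall_notMem]
  rintro ω ⟨-, hlow, hup⟩
  obtain ⟨B, hbB, hB⟩ := ENNReal.lt_iff_exists_real_btwn.1 hb |>.imp fun _ h => h.2
  have hB0 : 0 < B := ENNReal.ofReal_pos.1 (bot_le.trans_lt hbB)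
  have hB' : B < a / (1 - a) := (ENNReal.ofReal_lt_ofReal_iff'.1 hB).1
  have h1a : 0 < 1 - a := by linarith
  rw [lt_div_iff₀ h1a] at hB'
  have ha : 0 < a := by nlinarith
  -- The lower rate is only known to be ≥ a, so a is decreased slightly while B < a'/(1 - a') still
  -- holds.
  obtain ⟨a', h1, h2⟩ : ∃ a', B / (1 + B) < a' ∧ a' < a := by
    refine exists_between ?_
    rw [div_lt_iff₀ (by linarith)]
    linarith
  have ha' : 0 < a' := lt_trans (by positivity) h1
  rw [div_lt_iff₀ (by linarith)] at h1
  refine not_upperL_lt ha' (h2.trans ha1) (B := B) ?_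
    (lt_of_lt_of_le ((ENNReal.ofReal_lt_ofReal_iff ha).2 h2) hlow) (hup ▸ hbB)
  rw [lt_div_iff₀ (by linarith)]
  linarith

theorem dimCoeff_ofReal {a β : ℝ} (ha0 : 0 ≤ a) (hβ0 : 0 ≤ β) (h : a = 0 ∧ β = 0 ∨ a < β) :
    dimCoeff a (ENNReal.ofReal β) = (1 - a / (1 - a / β)) / (1 + β) := by
  rw [dimCoeff, if_neg ENNReal.ofReal_ne_top]
  rcases h with ⟨rfl, rfl⟩ | h
  · simp
  · have hne : ¬ (a = 0 ∧ ENNReal.ofReal β = 0) := by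
      rintro ⟨rfl, h0⟩
      rw [ENNReal.ofReal_eq_zero] at h0
      linarith
    rw [if_neg hne, ENNReal.toReal_ofReal hβ0]
    have h1 : β - a ≠ 0 := by linarith
    have h2 : 1 + β ≠ 0 := by linarith
    have hpos : β ≠ 0 := by linarith
    have h3 : 1 - a / β = (β - a) / β := by field_simp
    rw [h3]
    field_simp
    ring

theorem lt_of_div_one_sub_le {a β : ℝ} (ha : 0 < a) (ha1 : a < 1) (h : a / (1 - a) ≤ β) :
    a < β := by
  rw [div_le_iff₀ (by linarith)] at h
  nlinarith

/-- The difference of the coefficients is exactly ϱa²/((β - a)(β + ϱ - a)(1 + β)). From β(1 - a) ≥ a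
one gets (1 - a)(β - a) ≥ a², likewise with β + ϱ; then a⁵ ≤ a⁴ and 1 + β ≥ 1 finish. -/
theorem coeff_perturb_le {a β ϱ : ℝ} (ha : 0 < a) (ha1 : a < 1) (h : a / (1 - a) ≤ β)
    (hϱ : 0 < ϱ) : (1 - a / (1 - a / (β + ϱ))) / (1 + β) ≤
      (1 - a / (1 - a / β)) / (1 + β) + ϱ * (1 - a) ^ 2 / a ^ 3 := by
  have haβ := lt_of_div_one_sub_le ha ha1 h
  rw [div_le_iff₀ (by linarith)] at h
  have h1 : 0 < β - a := by linarith
  have h2 : 0 < β + ϱ - a := by linarith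
  have h3 : 0 < 1 + β := by linarith
  have e1 : 1 - a / β = (β - a) / β := by
    have : β ≠ 0 := by linarith
    field_simp
  have e2 : 1 - a / (β + ϱ) = (β + ϱ - a) / (β + ϱ) := by
    have : β + ϱ ≠ 0 := by linarith
    field_simp
  have e3 : (1 - a / (1 - a / (β + ϱ))) / (1 + β) =
      (1 - a / (1 - a / β)) / (1 + β) + ϱ * a ^ 2 / ((β - a) * (β + ϱ - a) * (1 + β)) := by
    rw [e1, e2]
    have : β ≠ 0 := by linarith
    have : β + ϱ ≠ 0 := by linarith
    field_simp
    ring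
  rw [e3]
  suffices hle : ϱ * a ^ 2 / ((β - a) * (β + ϱ - a) * (1 + β)) ≤ ϱ * (1 - a) ^ 2 / a ^ 3 by linarith
  rw [div_le_div_iff₀ (by positivity) (by positivity)]
  have k1 : a ^ 2 ≤ (1 - a) * (β - a) := by nlinarith
  have k2 : a ^ 2 ≤ (1 - a) * (β + ϱ - a) := by nlinarith
  have k3 : a ^ 2 * a ^ 2 ≤ ((1 - a) * (β - a)) * ((1 - a) * (β + ϱ - a)) :=
    mul_le_mul k1 k2 (by positivity) (mul_nonneg (by linarith) h1.le)
  have k4 : a ^ 5 ≤ a ^ 2 * a ^ 2 := by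
    rw [← pow_add]
    exact pow_le_pow_of_le_one ha.le ha1.le (by norm_num)
  have k5 : 0 ≤ ((1 - a) * (β - a)) * ((1 - a) * (β + ϱ - a)) := le_trans (by positivity) k3
  have k6 : a ^ 5 ≤ ((1 - a) * (β - a)) * ((1 - a) * (β + ϱ - a)) * (1 + β) := by
    nlinarith [mul_nonneg k5 (show 0 ≤ β by linarith)]
  calc ϱ * a ^ 2 * a ^ 3 = ϱ * a ^ 5 := by ring
    _ ≤ ϱ * (((1 - a) * (β - a)) * ((1 - a) * (β + ϱ - a)) * (1 + β)) := by gcongr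
    _ = _ := by ring

theorem dimH_levelSet_le (hm : 2 ≤ m) {S : Set (SymbolicSpace m)} (hS : IsSubshift S)
    (hne : S.Nonempty) {a β : ℝ} (ha0 : 0 ≤ a) (ha1 : a < 1) (hβ0 : 0 ≤ β)
    (hβ : a / (1 - a) ≤ β) :
    dimH (levelSet S (psiZero m) (ENNReal.ofReal a) (ENNReal.ofReal β)) ≤
      ENNReal.ofReal ((1 - a / (1 - a / β)) / (1 + β) * (topEntropy S / Real.log m)) := by
  rw [levelSet_psiZero hm]
  rcases ha0.eq_or_lt with rfl | ha
  · rcases hβ0.eq_or_lt with rfl | hpos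
    · simpa using (dimH_mono fun ω hω => hω.1).trans (dimH_subshift_le hm hS hne)
    · refine (dimH_mono ?_).trans ((dimH_le_upperL_le hm hS hne hpos).trans_eq ?_)
      · exact fun ω hω => ⟨hω.1, hω.2.2.ge⟩
      · simp
  · have haβ := lt_of_div_one_sub_le ha ha1 hβ
    refine (dimH_mono ?_).trans (dimH_lowerL_upperL_le hm hS hne ha (ha.trans haβ) haβ)
    exact fun ω hω => ⟨hω.1, hω.2.1, hω.2.2.ge, hω.2.2.le⟩

theorem le_dimH_levelSetStar (hm : 2 ≤ m) {S : Set (SymbolicSpace m)} (hS : IsSubshift S)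
    (hspec : HasSpecification S) (hent : 0 < topEntropy S) (hzero : zeroWord m ∈ S) {a β : ℝ}
    (ha0 : 0 ≤ a) (ha1 : a < 1) (hβ0 : 0 ≤ β) (hβ : a / (1 - a) ≤ β) :
    ENNReal.ofReal ((1 - a / (1 - a / β)) / (1 + β) * (topEntropy S / Real.log m)) ≤
      dimH (levelSetStar S (psiZero m) (ENNReal.ofReal a) (ENNReal.ofReal β)) := by
  rw [levelSetStar_psiZero hm]
  rcases ha0.eq_or_lt with rfl | ha
  · have := le_dimH_levels hm hS hspec hent hzero (a := 0) (b := β) (r := 0) hβ0 le_rfl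
      (by norm_num) (by norm_num)
    simpa using this
  · have haβ := lt_of_div_one_sub_le ha ha1 hβ
    have hβpos := ha.trans haβ
    rw [div_le_iff₀ (by linarith)] at hβ
    -- In the boundary case β(1 - a) = a no schedule with r = a/β exists, as r(1 + β) = 1, but the
    -- coefficient vanishes.
    rcases hβ.eq_or_lt with heq | hlt
    · have h0 : 1 - a / (1 - a / β) = 0 := by
        have h1 : 1 - a / β = (β - a) / β := by field_simp
        have h2 : β - a ≠ 0 := by linarith
        rw [h1]
        field_simp
        linarith
      simp [h0]
    · refine le_dimH_levels hm hS hspec hent hzero hβ0 (by positivity) ?_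
        (div_mul_cancel₀ a hβpos.ne')
      rw [div_mul_eq_mul_div, div_lt_one hβpos]
      linarith

theorem dimH_lowerL_upperL_add_le (hm : 2 ≤ m) {S : Set (SymbolicSpace m)} (hS : IsSubshift S)
    (hspec : HasSpecification S) (hent : 0 < topEntropy S) (hzero : zeroWord m ∈ S) {a β ϱ : ℝ}
    (ha : 0 < a) (ha1 : a < 1) (hβ : a / (1 - a) ≤ β) (hϱ : 0 < ϱ) :
    dimH {ω | ω ∈ S ∧ ENNReal.ofReal a ≤ lowerL ω ∧
        ENNReal.ofReal β ≤ upperL ω ∧ upperL ω ≤ ENNReal.ofReal β + ENNReal.ofReal ϱ} ≤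
      (ENNReal.ofReal (dimCoeff a (ENNReal.ofReal β)) +
        ENNReal.ofReal (ϱ * (1 - a) ^ 2) / ENNReal.ofReal (a ^ 3)) * dimH S := by
  have haβ := lt_of_div_one_sub_le ha ha1 hβ
  have hβ0 := ha.trans haβ
  have hD : 0 ≤ topEntropy S / Real.log m := div_nonneg hent.le (Real.log_natCast_nonneg m)
  rw [← ENNReal.ofReal_add hβ0.le hϱ.le, dimCoeff_ofReal ha.le hβ0.le (Or.inr haβ),
    dimH_subshift hm hS hspec hent hzero, ← ENNReal.ofReal_div_of_pos (by positivity)]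
  refine (dimH_lowerL_upperL_le hm hS ⟨_, hzero⟩ ha hβ0 (by linarith)).trans ?_
  refine (ENNReal.ofReal_le_ofReal
    (mul_le_mul_of_nonneg_right (coeff_perturb_le ha ha1 hβ hϱ) hD)).trans ?_
  rw [ENNReal.ofReal_mul' hD]
  gcongr
  exact ENNReal.ofReal_add_le

end Main

end ZeroRuns

theorem lemma4p1 (m : ℕ) [NeZero m] (hm : 2 ≤ m) (S : Set (SymbolicSpace m))
    (hS : IsSubshift S) (hspec : HasSpecification S) (hent : 0 < topEntropy S)
    (hzero : zeroWord m ∈ S) (a : ℝ) (ha0 : 0 ≤ a) (ha1 : a < 1) (b : ℝ≥0∞) :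
    (b < ENNReal.ofReal (a / (1 - a)) →
      levelSet S (psiZero m) (ENNReal.ofReal a) b = ∅) ∧
    (ENNReal.ofReal (a / (1 - a)) ≤ b →
      (dimH (levelSetStar S (psiZero m) (ENNReal.ofReal a) b) =
          dimH (levelSet S (psiZero m) (ENNReal.ofReal a) b) ∧
        dimH (levelSet S (psiZero m) (ENNReal.ofReal a) b) =
          ENNReal.ofReal (dimCoeff a b) * dimH S) ∧
      ∀ ϱ : ℝ, 0 < ϱ →
        dimH {ω | ω ∈ S ∧ ENNReal.ofReal a ≤ lowerL ω ∧
            b ≤ upperL ω ∧ upperL ω ≤ b + ENNReal.ofReal ϱ} ≤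
          (ENNReal.ofReal (dimCoeff a b) +
            ENNReal.ofReal (ϱ * (1 - a) ^ 2) / ENNReal.ofReal (a ^ 3)) * dimH S) := by
  refine ⟨levelSet_eq_empty hm S ha1, fun hab => ?_⟩
  have hsub : levelSetStar S (psiZero m) (ENNReal.ofReal a) b ⊆
      levelSet S (psiZero m) (ENNReal.ofReal a) b := fun ω hω => ⟨hω.1, hω.2.1.ge, hω.2.2⟩
  induction b with
  | top =>
    have htop := dimH_upperL_eq_top hm hS ⟨_, hzero⟩
    have h0 : dimH (levelSet S (psiZero m) (ENNReal.ofReal a) ⊤) = 0 := by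
      refine le_antisymm ((dimH_mono ?_).trans htop.le) zero_le
      rw [levelSet_psiZero hm]
      exact fun ω hω => ⟨hω.1, hω.2.2⟩
    refine ⟨⟨le_antisymm (dimH_mono hsub) (h0.le.trans zero_le), ?_⟩, fun ϱ _ => ?_⟩
    · rw [h0]
      simp [dimCoeff]
    · refine (dimH_mono ?_).trans (htop.le.trans zero_le)
      exact fun ω hω => ⟨hω.1, top_le_iff.1 hω.2.2.1⟩
  | coe b =>
    rw [← ENNReal.ofReal_coe_nnreal] at hab hsub ⊢
    have hβ0 : (0 : ℝ) ≤ b := b.coe_nonneg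
    generalize (b : ℝ) = β at hab hsub hβ0 ⊢
    have hβ : a / (1 - a) ≤ β := (ENNReal.ofReal_le_ofReal_iff hβ0).1 hab
    have hcase : a = 0 ∧ β = 0 ∨ a < β := by
      rcases ha0.eq_or_lt with rfl | ha
      · rcases hβ0.eq_or_lt with h | h
        · exact Or.inl ⟨rfl, h.symm⟩
        · exact Or.inr h
      · exact Or.inr (lt_of_div_one_sub_le ha ha1 hβ)
    have hD : 0 ≤ topEntropy S / Real.log m := div_nonneg hent.le (Real.log_natCast_nonneg m)
    have hup := dimH_levelSet_le hm hS ⟨_, hzero⟩ ha0 ha1 hβ0 hβ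
    have hlow := le_dimH_levelSetStar hm hS hspec hent hzero ha0 ha1 hβ0 hβ
    refine ⟨⟨le_antisymm (dimH_mono hsub) (hup.trans hlow), ?_⟩, fun ϱ hϱ => ?_⟩
    · rw [dimCoeff_ofReal ha0 hβ0 hcase, dimH_subshift hm hS hspec hent hzero,
        ← ENNReal.ofReal_mul' hD]
      exact le_antisymm hup (hlow.trans (dimH_mono hsub))
    · rcases ha0.eq_or_lt with rfl | ha
      · refine (dimH_mono fun ω hω => hω.1).trans (le_mul_of_one_le_left zero_le ?_)
        -- For a = 0 the quotient is a positive number over 0, which is ∞ in `ℝ≥0∞`.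
        have h1 : ENNReal.ofReal (ϱ * (1 - 0) ^ 2) / ENNReal.ofReal (0 ^ 3) = ⊤ := by
          have h2 : ENNReal.ofReal (ϱ * (1 - 0) ^ 2) ≠ 0 := by
            simpa using hϱ
          rw [zero_pow (by norm_num), ENNReal.ofReal_zero, ENNReal.div_zero h2]
        rw [h1, add_top]
        exact le_top
      · exact dimH_lowerL_upperL_add_le hm hS hspec hent hzero ha ha1 hβ hϱ
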